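/- Let $\Gamma$ be a discrete subgroup of $\mathrm{SL}_2(\mathbb R)$ (equivalently, through its image, a discrete subgroup of $\mathrm{PSL}_2(\mathbb R)$), acting on the upper half-plane $\mathbb H$ by Möbius transformations, and let $d\mu(z)=y^{-2}\,dx\,dy$, also as a measure on $\Gamma\backslash\mathbb H$. For $k\in\mathbb Z$ let $\mathfrak F_k$ be the space of functions $f:\mathbb H\to\mathbb C$ with $$f(\gamma z)=\left(\frac{cz+d}{c\bar z+d}\right)^k f(z)\qquad\text{for all }\gamma=\begin{pmatrix}a&b\\c&d\end{pmatrix}\in\Gamma ,$$ so that $|f|$ is a function on $\Gamma\backslash\mathbb H$, and let $$\Delta_k=y^2\left(\frac{\partial^2}{\partial x^2}+\frac{\partial^2}{\partial y^2}\right)-2iky\frac{\partial}{\partial x}.$$ A function $f\in\mathfrak F_k$ is called an eigenfunction of $\Delta_k$ with eigenvalue $s(1-s)$ if it is of class $C^2$ and $\Delta_kf+s(1-s)f=0$; write $s=\tfrac12+it$ with $t\in\mathbb C$. Theorem. Let $C\subseteq\Gamma\backslash\mathbb H$ be compact. Then there is a compact set $C'$ with $C\subseteq C'\subseteq\Gamma\backslash\mathbb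 H$, depending only on $\Gamma$ and $C$, such that for every integer $k$ and every $t_0>0$ there is a constant $A=A(\Gamma,C,k,t_0)>0$ with the following property: for every $t\in\mathbb C$ with $|t|\ge t_0$ and every eigenfunction $f\in\mathfrak F_k$ of $\Delta_k$ with eigenvalue $s(1-s)$, $s=\tfrac12+it$, the function $|f|^2$ is integrable on $C'$ and $$\sup_{z\in C}|f(z)|\;\le\;A\,|t|^{1/2}\left(\int_{C'}|f(z)|^2\,d\mu(z)\right)^{1/2}.$$ -/

import Mathlib

open UpperHalfPlane MeasureTheory
open scoped MatrixGroups ComplexConjugate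

noncomputable section

namespace WeightEigen

/-- The space of functions `f : ℍ → ℂ` of weight `k` for `Γ`, i.e. with
`f (γ z) = ((c z + d) / (c z̄ + d)) ^ k * f z` for all `γ ∈ Γ` with lower row `(c, d)`. -/
def weightSpace (Γ : Subgroup SL(2, ℝ)) (k : ℤ) : Set (ℍ → ℂ) :=
  {f | ∀ γ ∈ Γ, ∀ z : ℍ, f (γ • z) =
    ((((γ 1 0 : ℝ) : ℂ) * (z : ℂ) + ((γ 1 1 : ℝ) : ℂ)) /
      (((γ 1 0 : ℝ) : ℂ) * conj (z : ℂ) + ((γ 1 1 : ℝ) : ℂ))) ^ k * f z}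

/-- The partial derivative `∂F/∂x` of a function of `x + i y` (real direction `1`). -/
def partialX (F : ℂ → ℂ) (w : ℂ) : ℂ := lineDeriv ℝ F w 1

/-- The partial derivative `∂F/∂y` of a function of `x + i y` (real direction `i`). -/
def partialY (F : ℂ → ℂ) (w : ℂ) : ℂ := lineDeriv ℝ F w Complex.I

/-- The `k`-Laplacian `Δ_k = y² (∂²/∂x² + ∂²/∂y²) - 2 i k y ∂/∂x`. Here `f ∘ ofComplex` is `f`
seen as a function on the open set `{Im w > 0}` of `ℂ`. -/
def weightLaplacian (k : ℤ) (f : ℍ → ℂ) (z : ℍ) : ℂ :=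
  (z.im : ℂ) ^ 2 * (partialX (partialX (f ∘ ofComplex)) z + partialY (partialY (f ∘ ofComplex)) z)
    - 2 * Complex.I * k * z.im * partialX (f ∘ ofComplex) z

/-- `f` is a weight-`k` function for `Γ`, twice continuously differentiable (in the real sense),
with `Δ_k f + s (1 - s) f = 0`. -/
structure IsEigenfunction (Γ : Subgroup SL(2, ℝ)) (k : ℤ) (s : ℂ) (f : ℍ → ℂ) : Prop where
  mem_weightSpace : f ∈ weightSpace Γ k
  contDiffOn : ContDiffOn ℝ 2 (f ∘ ofComplex) {w : ℂ | 0 < w.im}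
  eigen : ∀ z : ℍ, weightLaplacian k f z + s * (1 - s) * f z = 0

/-- The quotient `Γ \ ℍ`, with the quotient topology and the quotient σ-algebra. -/
abbrev HQuot (Γ : Subgroup SL(2, ℝ)) : Type := MulAction.orbitRel.Quotient Γ ℍ

/-- The projection `ℍ → Γ \ ℍ`. -/
def proj (Γ : Subgroup SL(2, ℝ)) (z : ℍ) : HQuot Γ := Quotient.mk _ z

/-- The measure on `Γ \ ℍ` induced by `dμ = dx dy / y²` (which is `volume` on `ℍ`): the least
measure that dominates the image of `μ|_U` for each measurable set `U` of pairwise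
`Γ`-inequivalent points. For discrete `Γ`, the supremum is attained when `U` is a measurable
fundamental domain (with exactly one point in each orbit), so that this is integration over
any fundamental domain. -/
def quotMeasure (Γ : Subgroup SL(2, ℝ)) : Measure (HQuot Γ) :=
  sSup {ν | ∃ U : Set ℍ, MeasurableSet U ∧ Set.InjOn (proj Γ) U ∧
    ν = ((volume : Measure ℍ).restrict U).map (proj Γ)}

theorem norm_smul_eq {Γ : Subgroup SL(2, ℝ)} {k : ℤ} {f : ℍ → ℂ} (hf : f ∈ weightSpace Γ k)
    {γ : SL(2, ℝ)} (hγ : γ ∈ Γ) (z : ℍ) : ‖f (γ • z)‖ = ‖f z‖ := by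
  have hne : ((γ 1 0 : ℝ) : ℂ) * (z : ℂ) + ((γ 1 1 : ℝ) : ℂ) ≠ 0 := by
    simpa [UpperHalfPlane.denom] using UpperHalfPlane.denom_ne_zero (γ : GL (Fin 2) ℝ) z
  have hconj : ((γ 1 0 : ℝ) : ℂ) * conj (z : ℂ) + ((γ 1 1 : ℝ) : ℂ) =
      conj (((γ 1 0 : ℝ) : ℂ) * (z : ℂ) + ((γ 1 1 : ℝ) : ℂ)) := by
    simp
  rw [hf γ hγ z, hconj, norm_mul, norm_zpow, norm_div, RCLike.norm_conj,
    div_self (norm_ne_zero_iff.mpr hne), one_zpow, one_mul]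

/-- For `f` of weight `k`, the `Γ`-invariant function `|f|`, as a function on `Γ \ ℍ`. -/
def absQuot {Γ : Subgroup SL(2, ℝ)} {k : ℤ} {f : ℍ → ℂ} (hf : f ∈ weightSpace Γ k) :
    HQuot Γ → ℝ :=
  Quotient.lift (fun z => ‖f z‖) (by
    rintro _ w ⟨γ, rfl⟩
    exact norm_smul_eq hf γ.2 w)

end WeightEigen

end

/-!
The estimate is local. Around a point `z` of the half-plane, pass to the disc model with centre `z`
and multiply the eigenfunction by the factor `((1 - w̄) / (1 - w)) ^ k`. The eigenvalue equation
`Δ_k f + l f = 0`, `l = s (1 - s)`, then becomes invariant under rotations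
(`discRad₂_add_discAng₂`), so the angular mean `M(r)` solves the radial equation
`M'' + M' / r + q M = 0` with `q = 4 l / (1 - r²)² + 4 k² / (1 - r²)`; it is regular at `0`, and
`M(0)` is `f(z)` up to normalization. By Cauchy-Schwarz on circles, `∫ |M|² r dr` is at most a
constant times the integral of `|f|²` over the disc about `z`. It remains to bound `∫ |M|² r dr`
from below by a constant times `|M(0)|² / √(max (Re l) 1)`, uniformly in complex `l`; as
`Re l ≤ 1 / 4 + |t|²`, this is where the exponent `1 / 2` of `|t|` comes from.

The lower bound (`exists_norm_sq_le_integral`) is an energy argument. With `p` an upper bound for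
`Re q`, comparison with `1 - p r²` gives `|M|² ≥ |M(0)|² / 2` for `r ≤ r₀ = 1 / √(2 p)`
(`RadialSystem.half_le_near_zero`), which suffices when `Re l ≤ 1`. When `Re l ≥ 1`, the function
`u = √r M` solves `u'' + (q + 1 / (4 r²)) u = 0`, and its energy
`H = |u'|² + Re (q + 1 / (4 r²)) |u|²` satisfies `H' ≥ - |u|² / (2 r³)`: the potential has
nondecreasing real part, and the term of `H'` with `Im q` is nonnegative, because `Im q` has a
constant sign (`RadialSystem.im_mul_nonneg`). So the energy does not drop
(`RadialSystem.le_energy`) from its value at `r₀`, which is at least of the order of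
`Re l · r₀ |M(0)|²`, and the identity `(|u|²)'' + 4 Re (q + 1 / (4 r²)) |u|² = 2 H`, tested against
a bump, turns this into a lower bound for `∫ |u|² = ∫ |M|² r dr`
(`RadialSystem.energy_le_integral`).

On the quotient, lift `C` to a compact set `K` of the half-plane and let `K'` be the union of the
closed discs about the points of `K`, and `C'` the image of `K'`. Since `Γ` acts properly
discontinuously, finitely many translates of a set of representatives of the orbits meeting `K'`
cover `K'`, so that integrals over `K'` are bounded by a multiple of integrals over `C'`
(`exists_lintegral_le_nat_mul`), and `C'` has finite measure (`quotMeasure_image_lt_top`).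
-/

noncomputable section

namespace WeightEigen

/-! ### The radial equation: energy estimates -/

/-- Real and imaginary parts `M = a + i b`, `L = c + i d` of a solution on `[0, 1/2]` of the radial
equation `M' = L / r`, `L' = -r q M` with potential `q = P + i S`, regular at the origin. -/
structure RadialSystem (P S a b c d : ℝ → ℝ) : Prop where
  cont_a : ContinuousOn a (Set.Icc 0 (1 / 2))
  cont_b : ContinuousOn b (Set.Icc 0 (1 / 2))
  cont_c : ContinuousOn c (Set.Icc 0 (1 / 2))
  cont_d : ContinuousOn d (Set.Icc 0 (1 / 2))
  c_zero : c 0 = 0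
  d_zero : d 0 = 0
  deriv_a : ∀ r ∈ Set.Ioo (0 : ℝ) (1 / 2), HasDerivAt a (c r / r) r
  deriv_b : ∀ r ∈ Set.Ioo (0 : ℝ) (1 / 2), HasDerivAt b (d r / r) r
  deriv_c : ∀ r ∈ Set.Ioo (0 : ℝ) (1 / 2), HasDerivAt c (-r * (P r * a r - S r * b r)) r
  deriv_d : ∀ r ∈ Set.Ioo (0 : ℝ) (1 / 2), HasDerivAt d (-r * (P r * b r + S r * a r)) r

theorem monotoneOn_Icc_of_hasDerivAt {f f' : ℝ → ℝ} {x y : ℝ} (hf : ContinuousOn f (Set.Icc x y))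
    (hd : ∀ r ∈ Set.Ioo x y, HasDerivAt f (f' r) r) (h0 : ∀ r ∈ Set.Ioo x y, 0 ≤ f' r) :
    MonotoneOn f (Set.Icc x y) := by
  refine monotoneOn_of_hasDerivWithinAt_nonneg (f' := f') (convex_Icc x y) hf ?_ ?_
  · intro r hr
    rw [interior_Icc] at hr
    exact (hd r hr).hasDerivWithinAt
  · intro r hr
    rw [interior_Icc] at hr
    exact h0 r hr

namespace RadialSystem

variable {P S a b c d : ℝ → ℝ}

/-- Comparison of `N = |M|²` with `1 - p r²`, where `p` bounds the real part of the potential: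
the Wronskian `r (N' J - N J') / 2` with `J = 1 - p r²` is nondecreasing, whence so is `N / J`. -/
theorem half_le_near_zero (h : RadialSystem P S a b c d) {p R : ℝ} (hp : 0 ≤ p) (hR : R ≤ 1 / 2)
    (hpR : p * R ^ 2 ≤ 1 / 2) (hP : ∀ r ∈ Set.Ioo (0 : ℝ) (1 / 2), P r ≤ p) {r : ℝ}
    (hr : r ∈ Set.Icc 0 R) :
    (a 0 ^ 2 + b 0 ^ 2) / 2 ≤ a r ^ 2 + b r ^ 2 := by
  have hsub : Set.Icc 0 R ⊆ Set.Icc (0 : ℝ) (1 / 2) := Set.Icc_subset_Icc_right hR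
  have hsub' : Set.Ioo 0 R ⊆ Set.Ioo (0 : ℝ) (1 / 2) := Set.Ioo_subset_Ioo_right hR
  have ca := h.cont_a.mono hsub
  have cb := h.cont_b.mono hsub
  have cc := h.cont_c.mono hsub
  have cd := h.cont_d.mono hsub
  have hJ : ∀ x ∈ Set.Icc 0 R, 1 / 2 ≤ 1 - p * x ^ 2 := by
    intro x hx
    have : p * x ^ 2 ≤ p * R ^ 2 :=
      mul_le_mul_of_nonneg_left (pow_le_pow_left₀ hx.1 hx.2 2) hp
    linarith
  have hRR : 0 ≤ R := hr.1.trans hr.2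
  have hW : MonotoneOn (fun x => (a x * c x + b x * d x) * (1 - p * x ^ 2)
      + p * x ^ 2 * (a x ^ 2 + b x ^ 2)) (Set.Icc 0 R) := by
    refine monotoneOn_Icc_of_hasDerivAt (f' := fun x => (c x ^ 2 + d x ^ 2) / x * (1 - p * x ^ 2)
      + x * (a x ^ 2 + b x ^ 2) * (2 * p - P x * (1 - p * x ^ 2))) (by fun_prop) ?_ ?_
    · intro x hx
      have hx' := hsub' hx
      have hx0 : x ≠ 0 := hx.1.ne'
      have da := h.deriv_a x hx'
      have db := h.deriv_b x hx'
      have dc := h.deriv_c x hx'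
      have dd := h.deriv_d x hx'
      have dx : HasDerivAt (fun x : ℝ => p * x ^ 2) (p * (2 * x)) x := by
        simpa using (hasDerivAt_pow 2 x).const_mul p
      convert! (((da.mul dc).add (db.mul dd)).mul (dx.const_sub 1)).add
        (dx.mul ((da.pow 2).add (db.pow 2))) using 1
      simp only [Pi.add_apply, Pi.mul_apply, Pi.pow_apply]
      field_simp
      ring
    · intro x hx
      have h1 := hJ x (Set.Ioo_subset_Icc_self hx)
      have h2 := hP x (hsub' hx)
      have h3 : 0 < x := hx.1
      have h4 : P x * (1 - p * x ^ 2) ≤ p := by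
        calc P x * (1 - p * x ^ 2) ≤ p * (1 - p * x ^ 2) :=
              mul_le_mul_of_nonneg_right h2 (by linarith)
          _ ≤ p * 1 := mul_le_mul_of_nonneg_left (by nlinarith [sq_nonneg x]) hp
          _ = p := mul_one p
      have h5 : 0 ≤ (c x ^ 2 + d x ^ 2) / x * (1 - p * x ^ 2) :=
        mul_nonneg (by positivity) (by linarith)
      have h6 : 0 ≤ x * (a x ^ 2 + b x ^ 2) * (2 * p - P x * (1 - p * x ^ 2)) :=
        mul_nonneg (by positivity) (by linarith)
      linarith
  have hW0 : ∀ x ∈ Set.Icc 0 R, 0 ≤ (a x * c x + b x * d x) * (1 - p * x ^ 2)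
      + p * x ^ 2 * (a x ^ 2 + b x ^ 2) := by
    intro x hx
    have := hW (Set.left_mem_Icc.mpr hRR) hx hx.1
    simpa [h.c_zero, h.d_zero] using this
  have hQ : MonotoneOn (fun x => (a x ^ 2 + b x ^ 2) / (1 - p * x ^ 2)) (Set.Icc 0 R) := by
    refine monotoneOn_Icc_of_hasDerivAt (f' := fun x => 2 * ((a x * c x + b x * d x) *
      (1 - p * x ^ 2) + p * x ^ 2 * (a x ^ 2 + b x ^ 2)) / (x * (1 - p * x ^ 2) ^ 2)) ?_ ?_ ?_
    · refine ContinuousOn.div (by fun_prop) (by fun_prop) fun x hx => ?_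
      linarith [hJ x hx]
    · intro x hx
      have hx' := hsub' hx
      have hx0 : x ≠ 0 := hx.1.ne'
      have hJx : 1 - p * x ^ 2 ≠ 0 := by linarith [hJ x (Set.Ioo_subset_Icc_self hx)]
      have da := h.deriv_a x hx'
      have db := h.deriv_b x hx'
      have dx : HasDerivAt (fun x : ℝ => p * x ^ 2) (p * (2 * x)) x := by
        simpa using (hasDerivAt_pow 2 x).const_mul p
      convert! ((da.pow 2).add (db.pow 2)).div (dx.const_sub 1) hJx using 1
      simp only [Pi.add_apply, Pi.pow_apply]
      field_simp
      ring
    · intro x hx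
      have := hW0 x (Set.Ioo_subset_Icc_self hx)
      have h3 : 0 < x := hx.1
      positivity
  have key := hQ (Set.left_mem_Icc.mpr hRR) hr hr.1
  have hJr := hJ r hr
  simp only [ne_eq, OfNat.ofNat_ne_zero, not_false_eq_true, zero_pow, mul_zero, sub_zero,
    div_one] at key
  rw [le_div_iff₀ (by linarith)] at key
  nlinarith [sq_nonneg (a 0), sq_nonneg (b 0)]

/-- When `S = Im q` has a constant sign, so has `Im (M conj L)`, since
its derivative is `r S |M|²`. -/
theorem im_mul_nonneg (h : RadialSystem P S a b c d) {σ : ℝ} {g : ℝ → ℝ}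
    (hS : ∀ r ∈ Set.Ioo (0 : ℝ) (1 / 2), S r = σ * g r)
    (hg : ∀ r ∈ Set.Ioo (0 : ℝ) (1 / 2), 0 ≤ g r) {r : ℝ} (hr : r ∈ Set.Ioo (0 : ℝ) (1 / 2)) :
    0 ≤ S r * (b r * c r - a r * d r) := by
  have ca := h.cont_a
  have cb := h.cont_b
  have cc := h.cont_c
  have cd := h.cont_d
  have hK : MonotoneOn (fun x => σ * (b x * c x - a x * d x)) (Set.Icc 0 (1 / 2)) := by
    refine monotoneOn_Icc_of_hasDerivAt (f' := fun x => x * (σ ^ 2 * g x) * (a x ^ 2 + b x ^ 2))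
      (by fun_prop) ?_ ?_
    · intro x hx
      have da := h.deriv_a x hx
      have db := h.deriv_b x hx
      have dc := h.deriv_c x hx
      have dd := h.deriv_d x hx
      convert! ((db.mul dc).sub (da.mul dd)).const_mul σ using 1
      rw [hS x hx]
      ring
    · intro x hx
      have := hg x hx
      have h3 : 0 < x := hx.1
      positivity
  have key := hK (Set.left_mem_Icc.mpr (by norm_num)) (Set.Ioo_subset_Icc_self hr) hr.1.le
  simp only [h.c_zero, h.d_zero, mul_zero, sub_zero] at key
  rw [hS r hr]
  have := mul_nonneg (hg r hr) key
  linarith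

/-- The energy `|u'|² + Re (q + 1 / (4 r²)) |u|²` of `u = √r M`, which solves
`u'' + (q + 1 / (4 r²)) u = 0`. -/
def energy (P a b c d : ℝ → ℝ) (r : ℝ) : ℝ :=
  ((c r + a r / 2) ^ 2 + (d r + b r / 2) ^ 2) / r + (P r * r + 1 / (4 * r)) * (a r ^ 2 + b r ^ 2)

theorem hasDerivAt_energy (h : RadialSystem P S a b c d) {r P' : ℝ}
    (hr : r ∈ Set.Ioo (0 : ℝ) (1 / 2)) (hP : HasDerivAt P P' r) :
    HasDerivAt (energy P a b c d) (P' * r * (a r ^ 2 + b r ^ 2) - (a r ^ 2 + b r ^ 2) / (2 * r ^ 2)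
      + 2 * (S r * (b r * c r - a r * d r))) r := by
  have hr0 : r ≠ 0 := hr.1.ne'
  have da := h.deriv_a r hr
  have db := h.deriv_b r hr
  have dc := h.deriv_c r hr
  have dd := h.deriv_d r hr
  have d1 : HasDerivAt (fun x : ℝ => 1 / (4 * x)) (-1 / (4 * r ^ 2)) r := by
    convert! ((hasDerivAt_id r).const_mul (4 : ℝ)).inv (by simpa using hr0) using 1
    · ext x; simp
    · simp; field_simp
  unfold energy
  convert! ((((dc.add (da.div_const 2)).pow 2).add ((dd.add (db.div_const 2)).pow 2)).div
    (hasDerivAt_id r) hr0).add (((hP.mul (hasDerivAt_id r)).add d1).mul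
    ((da.pow 2).add (db.pow 2))) using 1
  simp only [Pi.add_apply, Pi.pow_apply, Pi.mul_apply, id]
  field_simp
  ring

/-- The energy cannot drop: its quotient by `p₀ + 1 / (4 r²)` is nondecreasing. -/
theorem le_energy (h : RadialSystem P S a b c d) {P' : ℝ → ℝ} {p₀ r₀ r : ℝ} (hp₀ : 0 < p₀)
    (hP : ∀ r ∈ Set.Ioo (0 : ℝ) (1 / 2), HasDerivAt P (P' r) r)
    (hP' : ∀ r ∈ Set.Ioo (0 : ℝ) (1 / 2), 0 ≤ P' r)
    (hPp : ∀ r ∈ Set.Ioo (0 : ℝ) (1 / 2), p₀ ≤ P r)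
    (hS : ∀ r ∈ Set.Ioo (0 : ℝ) (1 / 2), 0 ≤ S r * (b r * c r - a r * d r))
    (hr₀ : 0 < r₀) (hr : r₀ ≤ r) (hr2 : r < 1 / 2) :
    p₀ * (r₀ * (a r₀ ^ 2 + b r₀ ^ 2)) ≤ energy P a b c d r := by
  have hsub : Set.Icc r₀ r ⊆ Set.Ioo (0 : ℝ) (1 / 2) := fun x hx =>
    ⟨hr₀.trans_le hx.1, hx.2.trans_lt hr2⟩
  have hlow : ∀ x ∈ Set.Icc r₀ r, (p₀ + 1 / (4 * x ^ 2)) * (x * (a x ^ 2 + b x ^ 2)) ≤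
      energy P a b c d x := by
    intro x hx
    have hx0 : 0 < x := hr₀.trans_le hx.1
    have e1 : (p₀ + 1 / (4 * x ^ 2)) * (x * (a x ^ 2 + b x ^ 2)) =
        (p₀ * x + 1 / (4 * x)) * (a x ^ 2 + b x ^ 2) := by
      field_simp
    have e2 : p₀ * x ≤ P x * x := mul_le_mul_of_nonneg_right (hPp x (hsub hx)) hx0.le
    have e3 : (p₀ * x + 1 / (4 * x)) * (a x ^ 2 + b x ^ 2) ≤
        (P x * x + 1 / (4 * x)) * (a x ^ 2 + b x ^ 2) :=
      mul_le_mul_of_nonneg_right (by linarith) (by positivity)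
    have e4 : 0 ≤ ((c x + a x / 2) ^ 2 + (d x + b x / 2) ^ 2) / x := by positivity
    rw [e1, energy]
    linarith
  have hw : ∀ x : ℝ, 0 < x → HasDerivAt (fun x : ℝ => p₀ + 1 / (4 * x ^ 2))
      (-1 / (2 * x ^ 3)) x := by
    intro x hx
    have hx0 : x ≠ 0 := hx.ne'
    convert! (((hasDerivAt_pow 2 x).const_mul (4 : ℝ)).inv (by positivity)).const_add p₀ using 1
    · ext y; simp
    · simp; field_simp; norm_num
  have hder : ∀ x ∈ Set.Icc r₀ r, HasDerivAt (fun x => energy P a b c d x / (p₀ + 1 / (4 * x ^ 2)))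
      (((P' x * x * (a x ^ 2 + b x ^ 2) - (a x ^ 2 + b x ^ 2) / (2 * x ^ 2)
      + 2 * (S x * (b x * c x - a x * d x))) * (p₀ + 1 / (4 * x ^ 2)) -
      energy P a b c d x * (-1 / (2 * x ^ 3))) / (p₀ + 1 / (4 * x ^ 2)) ^ 2) x := by
    intro x hx
    have hx0 : 0 < x := hr₀.trans_le hx.1
    exact (h.hasDerivAt_energy (hsub hx) (hP x (hsub hx))).div (hw x hx0) (by positivity)
  have hmono := monotoneOn_Icc_of_hasDerivAt
    (fun x hx => (hder x hx).continuousAt.continuousWithinAt)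
    (fun x hx => hder x (Set.Ioo_subset_Icc_self hx)) (fun x hx => by
      have hx' := Set.Ioo_subset_Icc_self hx
      have hx0 : 0 < x := hr₀.trans_le hx'.1
      have e1 := hlow x hx'
      have e2 := hS x (hsub hx')
      have e3 := hP' x (hsub hx')
      refine div_nonneg ?_ (by positivity)
      have e4 : (p₀ + 1 / (4 * x ^ 2)) * (x * (a x ^ 2 + b x ^ 2)) * (1 / (2 * x ^ 3)) ≤
        energy P a b c d x * (1 / (2 * x ^ 3)) := mul_le_mul_of_nonneg_right e1 (by positivity)
      have e5 : (p₀ + 1 / (4 * x ^ 2)) * (x * (a x ^ 2 + b x ^ 2)) * (1 / (2 * x ^ 3)) =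
        (p₀ + 1 / (4 * x ^ 2)) * ((a x ^ 2 + b x ^ 2) / (2 * x ^ 2)) := by
        field_simp
      have e6 : 0 ≤ (P' x * x * (a x ^ 2 + b x ^ 2) + 2 * (S x * (b x * c x - a x * d x))) *
          (p₀ + 1 / (4 * x ^ 2)) := by positivity
      have e7 : energy P a b c d x * (-1 / (2 * x ^ 3)) =
        - (energy P a b c d x * (1 / (2 * x ^ 3))) := by ring
      rw [e7]
      linarith)
  have key := hmono (Set.left_mem_Icc.mpr hr) (Set.right_mem_Icc.mpr hr) hr
  have hr0 : 0 < r := hr₀.trans_le hr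
  have h1 := hlow r₀ (Set.left_mem_Icc.mpr hr)
  have h2 : r₀ * (a r₀ ^ 2 + b r₀ ^ 2) ≤ energy P a b c d r / (p₀ + 1 / (4 * r ^ 2)) := by
    refine le_trans ?_ key
    rw [le_div_iff₀ (by positivity)]
    linarith
  rw [le_div_iff₀ (by positivity)] at h2
  have h3 : 0 ≤ r₀ * (a r₀ ^ 2 + b r₀ ^ 2) * (1 / (4 * r ^ 2)) := by positivity
  linarith

/-- A lower bound `e` for the energy on `[1/4, 1/2]` bounds `∫ |u|²` from below: test the identity
`(|u|²)'' + 4 Re (q + 1 / (4 r²)) |u|² = 2 (energy)` against the bump `(r - 1/4)² (1/2 - r)²`,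
whose integral is `1 / 30720`. -/
theorem energy_le_integral (h : RadialSystem P S a b c d) {p e : ℝ} (hp : 2 ≤ p)
    (hP : ∀ r ∈ Set.Ioo (0 : ℝ) (1 / 2), P r ≤ p)
    (he : ∀ r ∈ Set.Ioo (1 / 4 : ℝ) (1 / 2), e ≤ energy P a b c d r) :
    e ≤ 15360 * p * ∫ r in (1 / 4 : ℝ)..(1 / 2), r * (a r ^ 2 + b r ^ 2) := by
  have hsub : Set.Icc (1 / 4) (1 / 2) ⊆ Set.Icc (0 : ℝ) (1 / 2) :=
    Set.Icc_subset_Icc_left (by norm_num)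
  have ca := h.cont_a.mono hsub
  have cb := h.cont_b.mono hsub
  have cc := h.cont_c.mono hsub
  have cd := h.cont_d.mono hsub
  -- With `n = |u|²`, `φ` the bump and `Φ` a primitive of it, this is `2 e Φ - (n' φ - n φ')`.
  have key := intervalIntegral.sub_le_integral_of_hasDeriv_right_of_le
    (a := (1 / 4 : ℝ)) (b := 1 / 2)
    (g := fun r => 2 * e * ((r - 3 / 8) ^ 5 / 5 - (r - 3 / 8) ^ 3 / 96 + (r - 3 / 8) / 4096) -
      ((a r ^ 2 + b r ^ 2 + 2 * (a r * c r + b r * d r)) * ((r - 3 / 8) ^ 2 - 1 / 64) ^ 2 -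
        r * (a r ^ 2 + b r ^ 2) * (4 * (r - 3 / 8) * ((r - 3 / 8) ^ 2 - 1 / 64))))
    (g' := fun r => 2 * e * ((r - 3 / 8) ^ 2 - 1 / 64) ^ 2 -
      ((2 * energy P a b c d r - (4 * P r + 1 / r ^ 2) * (r * (a r ^ 2 + b r ^ 2))) *
        ((r - 3 / 8) ^ 2 - 1 / 64) ^ 2 -
        r * (a r ^ 2 + b r ^ 2) * (12 * (r - 3 / 8) ^ 2 - 1 / 16)))
    (φ := fun r => p * (r * (a r ^ 2 + b r ^ 2))) (by norm_num) (by fun_prop) ?_ ?_ ?_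
  · rw [intervalIntegral.integral_const_mul] at key
    norm_num at key ⊢
    linarith
  · intro r hr
    have hr' : r ∈ Set.Ioo (0 : ℝ) (1 / 2) := ⟨by linarith [hr.1], hr.2⟩
    have hr0 : r ≠ 0 := hr'.1.ne'
    have da := h.deriv_a r hr'
    have db := h.deriv_b r hr'
    have dc := h.deriv_c r hr'
    have dd := h.deriv_d r hr'
    have dx : HasDerivAt (fun x : ℝ => x - 3 / 8) 1 r := (hasDerivAt_id r).sub_const _
    have dN := (da.pow 2).add (db.pow 2)
    have dV := ((da.mul dc).add (db.mul dd)).const_mul 2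
    refine HasDerivAt.hasDerivWithinAt ?_
    convert! (((((dx.pow 5).div_const 5).sub ((dx.pow 3).div_const 96)).add
      (dx.div_const 4096)).const_mul (2 * e)).sub (((dN.add dV).mul
        (((dx.pow 2).sub_const (1 / 64)).pow 2)).sub (((hasDerivAt_id r).mul dN).mul
        ((dx.const_mul 4).mul ((dx.pow 2).sub_const (1 / 64))))) using 1
    simp only [Pi.add_apply, Pi.pow_apply, Pi.mul_apply, id, energy]
    field_simp
    ring
  · exact ContinuousOn.integrableOn_Icc (by fun_prop)
  · intro r hr
    have hr' : r ∈ Set.Ioo (0 : ℝ) (1 / 2) := ⟨by linarith [hr.1], hr.2⟩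
    have hr0 : 0 < r := hr'.1
    have h1 := he r hr
    have h2 := hP r hr'
    set x := r - 3 / 8 with hx
    have hx2 : x ^ 2 ≤ 1 / 64 := by
      have h3 : -(1 / 8) < x := by rw [hx]; linarith [hr.1]
      have h4 : x < 1 / 8 := by rw [hx]; linarith [hr.2]
      nlinarith
    have hφ : (x ^ 2 - 1 / 64) ^ 2 ≤ 1 / 4096 := by nlinarith [sq_nonneg x]
    have hn : 0 ≤ r * (a r ^ 2 + b r ^ 2) := by positivity
    have e1 : e * (x ^ 2 - 1 / 64) ^ 2 ≤ energy P a b c d r * (x ^ 2 - 1 / 64) ^ 2 :=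
      mul_le_mul_of_nonneg_right h1 (sq_nonneg _)
    have hr2 : 1 / r ^ 2 ≤ 16 := by
      rw [div_le_iff₀ (by positivity)]
      nlinarith [hr.1]
    have e2 : (4 * P r + 1 / r ^ 2) * (x ^ 2 - 1 / 64) ^ 2 + (12 * x ^ 2 - 1 / 16) ≤ p := by
      have : 1 / r ^ 2 * (x ^ 2 - 1 / 64) ^ 2 ≤ 16 * (x ^ 2 - 1 / 64) ^ 2 :=
        mul_le_mul_of_nonneg_right hr2 (sq_nonneg _)
      have : P r * (x ^ 2 - 1 / 64) ^ 2 ≤ p * (x ^ 2 - 1 / 64) ^ 2 :=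
        mul_le_mul_of_nonneg_right h2 (sq_nonneg _)
      have : p * (x ^ 2 - 1 / 64) ^ 2 ≤ p * (1 / 4096) :=
        mul_le_mul_of_nonneg_left hφ (by linarith)
      nlinarith
    have e3 := mul_le_mul_of_nonneg_right e2 hn
    nlinarith

end RadialSystem

/-! ### The radial equation of the disc model -/

/-- The potential `q` of the radial equation `M'' + M' / r + q M = 0` in the disc model. -/
def radialPotential (k : ℤ) (l : ℂ) (r : ℝ) : ℂ :=
  4 * l / (1 - r ^ 2) ^ 2 + 4 * k ^ 2 / (1 - r ^ 2)

theorem radialPotential_re (k : ℤ) (l : ℂ) (r : ℝ) :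
    (radialPotential k l r).re = 4 * l.re / (1 - r ^ 2) ^ 2 + 4 * k ^ 2 / (1 - r ^ 2) := by
  have h : radialPotential k l r =
      l * ((4 / (1 - r ^ 2) ^ 2 : ℝ) : ℂ) + ((4 * k ^ 2 / (1 - r ^ 2) : ℝ) : ℂ) := by
    unfold radialPotential
    push_cast
    ring
  rw [h, Complex.add_re, Complex.re_mul_ofReal, Complex.ofReal_re]
  ring

theorem radialPotential_im (k : ℤ) (l : ℂ) (r : ℝ) :
    (radialPotential k l r).im = l.im * (4 / (1 - r ^ 2) ^ 2) := by
  have h : radialPotential k l r =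
      l * ((4 / (1 - r ^ 2) ^ 2 : ℝ) : ℂ) + ((4 * k ^ 2 / (1 - r ^ 2) : ℝ) : ℂ) := by
    unfold radialPotential
    push_cast
    ring
  rw [h, Complex.add_im, Complex.im_mul_ofReal, Complex.ofReal_im, add_zero]

theorem three_fourths_lt_one_sub_sq {r : ℝ} (hr : r ∈ Set.Ioo (0 : ℝ) (1 / 2)) :
    3 / 4 < 1 - r ^ 2 := by
  nlinarith [hr.1, hr.2]

theorem radialPotential_re_le (k : ℤ) (l : ℂ) {r : ℝ} (hr : r ∈ Set.Ioo (0 : ℝ) (1 / 2)) :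
    (radialPotential k l r).re ≤ (8 + 6 * k ^ 2) * max l.re 1 := by
  have h := three_fourths_lt_one_sub_sq hr
  rw [radialPotential_re]
  set x := 1 - r ^ 2
  have hm : 1 ≤ max l.re 1 := le_max_right _ _
  have h1 : 4 * l.re / x ^ 2 ≤ 8 * max l.re 1 := by
    rw [div_le_iff₀ (by positivity)]
    have : 1 / 2 ≤ x ^ 2 := by nlinarith
    nlinarith [le_max_left l.re 1]
  have h2 : 4 * (k : ℝ) ^ 2 / x ≤ 6 * k ^ 2 * max l.re 1 := by
    rw [div_le_iff₀ (by positivity)]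
    have h3 : 1 * (3 / 4) ≤ max l.re 1 * x := mul_le_mul hm h.le (by norm_num) (by positivity)
    nlinarith [sq_nonneg (k : ℝ)]
  linarith

theorem le_radialPotential_re (k : ℤ) {l : ℂ} (hl : 0 ≤ l.re) {r : ℝ}
    (hr : r ∈ Set.Ioo (0 : ℝ) (1 / 2)) : 4 * l.re ≤ (radialPotential k l r).re := by
  have h := three_fourths_lt_one_sub_sq hr
  rw [radialPotential_re]
  have hx1 : 1 - r ^ 2 ≤ 1 := by nlinarith [sq_nonneg r]
  set x := 1 - r ^ 2
  have h1 : 4 * l.re ≤ 4 * l.re / x ^ 2 := by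
    rw [le_div_iff₀ (by positivity)]
    have : x ^ 2 ≤ 1 := by nlinarith
    nlinarith
  have h2 : 0 ≤ 4 * (k : ℝ) ^ 2 / x := by positivity
  linarith

theorem hasDerivAt_radialPotential_re (k : ℤ) (l : ℂ) {r : ℝ} (hr : r ∈ Set.Ioo (0 : ℝ) (1 / 2)) :
    HasDerivAt (fun r => (radialPotential k l r).re)
      (16 * l.re * r / (1 - r ^ 2) ^ 3 + 8 * k ^ 2 * r / (1 - r ^ 2) ^ 2) r := by
  have h := three_fourths_lt_one_sub_sq hr
  have hx : 1 - r ^ 2 ≠ 0 := by linarith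
  simp only [radialPotential_re]
  have dx : HasDerivAt (fun r : ℝ => 1 - r ^ 2) (-(2 * r)) r := by
    simpa using (hasDerivAt_pow 2 r).const_sub 1
  convert! ((hasDerivAt_const r (4 * l.re)).div (dx.pow 2) (pow_ne_zero 2 hx)).add
    ((hasDerivAt_const r (4 * (k : ℝ) ^ 2)).div dx hx) using 1
  simp only [Pi.pow_apply]
  field_simp
  ring

/-- A solution of the radial equation that is regular at the origin has an `L²` mass of at least
the order of `|M 0|² / √(max (Re l) 1)`. Near the origin this is the comparison with `1 - p r²`;
for large `Re l` the mass on `[1/4, 1/2]` is bounded below through the energy at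
`r₀ = 1 / √(2 p)`, where `p` is of the order of `Re l`. -/
theorem exists_norm_sq_le_integral (k : ℤ) : ∃ C : ℝ, 0 < C ∧ ∀ (l : ℂ) (M L : ℝ → ℂ),
    ContinuousOn M (Set.Icc 0 (1 / 2)) → ContinuousOn L (Set.Icc 0 (1 / 2)) → L 0 = 0 →
    (∀ r ∈ Set.Ioo (0 : ℝ) (1 / 2), HasDerivAt M (L r / r) r) →
    (∀ r ∈ Set.Ioo (0 : ℝ) (1 / 2), HasDerivAt L (-r * (radialPotential k l r * M r)) r) →
    ‖M 0‖ ^ 2 ≤ C * √(max l.re 1) * ∫ r in (0 : ℝ)..(1 / 2), r * ‖M r‖ ^ 2 := by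
  set κ : ℝ := 8 + 6 * (k : ℝ) ^ 2 with hκ
  have hκ8 : 8 ≤ κ := by nlinarith [sq_nonneg (k : ℝ)]
  -- For `Re l ≥ 1` the constant is `15360 p s / (2 m)` with `m = Re l`, `p = κ m`, `s = √(2 p)`.
  refine ⟨7680 * κ * √(2 * κ), by positivity, fun l M L cM cL hL0 dM dL => ?_⟩
  have h : RadialSystem (fun r => (radialPotential k l r).re) (fun r => (radialPotential k l r).im)
      (fun r => (M r).re) (fun r => (M r).im) (fun r => (L r).re) (fun r => (L r).im) := by
    refine ⟨Complex.continuous_re.comp_continuousOn cM, Complex.continuous_im.comp_continuousOn cM,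
      Complex.continuous_re.comp_continuousOn cL, Complex.continuous_im.comp_continuousOn cL,
      by simp [hL0], by simp [hL0], fun r hr => ?_, fun r hr => ?_, fun r hr => ?_,
      fun r hr => ?_⟩
    · convert! Complex.reCLM.hasFDerivAt.comp_hasDerivAt r (dM r hr) using 1
      simp [Complex.div_ofReal_re]
    · convert! Complex.imCLM.hasFDerivAt.comp_hasDerivAt r (dM r hr) using 1
      simp [Complex.div_ofReal_im]
    · convert! Complex.reCLM.hasFDerivAt.comp_hasDerivAt r (dL r hr) using 1
      simp
    · convert! Complex.imCLM.hasFDerivAt.comp_hasDerivAt r (dL r hr) using 1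
      simp
  set N : ℝ → ℝ := fun r => (M r).re ^ 2 + (M r).im ^ 2 with hN
  have hNM : ∀ r, ‖M r‖ ^ 2 = N r := fun r => by
    rw [← Complex.normSq_eq_norm_sq, Complex.normSq_apply, hN]
    ring
  simp only [hNM]
  have hN0 : ∀ r, 0 ≤ N r := fun r => by positivity
  have cN : ContinuousOn (fun r => r * N r) (Set.Icc 0 (1 / 2)) := by
    have ca := h.cont_a
    have cb := h.cont_b
    fun_prop
  have hint : ∀ x y : ℝ, x ∈ Set.Icc (0 : ℝ) (1 / 2) → y ∈ Set.Icc (0 : ℝ) (1 / 2) →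
      IntervalIntegrable (fun r => r * N r) volume x y := fun x y hx hy =>
    (cN.mono (Set.uIcc_subset_Icc hx hy)).intervalIntegrable
  have hsplit : ∀ x ∈ Set.Icc (0 : ℝ) (1 / 2),
      (∫ r in (0 : ℝ)..(1 / 2), r * N r) = (∫ r in (0 : ℝ)..x, r * N r) +
        ∫ r in x..(1 / 2), r * N r := fun x hx =>
    (intervalIntegral.integral_add_adjacent_intervals (hint 0 x (by simp) hx)
      (hint x (1 / 2) hx (by simp))).symm
  have hI0 : ∀ x ∈ Set.Icc (0 : ℝ) (1 / 2), 0 ≤ ∫ r in (0 : ℝ)..x, r * N r := fun x hx =>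
    intervalIntegral.integral_nonneg hx.1 fun r hr => mul_nonneg hr.1 (hN0 r)
  have hI1 : ∀ x ∈ Set.Icc (0 : ℝ) (1 / 2), 0 ≤ ∫ r in x..(1 / 2), r * N r := fun x hx =>
    intervalIntegral.integral_nonneg hx.2 fun r hr => mul_nonneg (hx.1.trans hr.1) (hN0 r)
  set m := max l.re 1 with hm
  have hm1 : 1 ≤ m := le_max_right _ _
  set p := κ * m with hp
  have hp8 : 8 ≤ p := by nlinarith
  have hPp : ∀ r ∈ Set.Ioo (0 : ℝ) (1 / 2), (radialPotential k l r).re ≤ p := fun r hr =>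
    radialPotential_re_le k l hr
  set s := √(2 * p) with hs
  have hs2 : s ^ 2 = 2 * p := Real.sq_sqrt (by positivity)
  have hs4 : 4 ≤ s := by
    rw [hs]
    refine Real.le_sqrt_of_sq_le ?_
    linarith
  have hsm : s = √(2 * κ) * √m := by
    rw [hs, hp, ← mul_assoc, Real.sqrt_mul (by positivity)]
  have hr₀ : s⁻¹ ∈ Set.Icc (0 : ℝ) (1 / 4) := by
    refine ⟨by positivity, ?_⟩
    rw [one_div]
    exact inv_anti₀ (by norm_num) hs4
  have hr₀' : s⁻¹ ∈ Set.Icc (0 : ℝ) (1 / 2) := ⟨hr₀.1, by linarith [hr₀.2]⟩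
  have hnear : ∀ r ∈ Set.Icc (0 : ℝ) s⁻¹, N 0 / 2 ≤ N r := fun r hr =>
    h.half_le_near_zero (p := p) (by positivity) hr₀'.2
      (by rw [inv_pow, hs2]; field_simp; rfl) hPp hr
  rcases le_total l.re 1 with hl | hl
  · have hm' : m = 1 := max_eq_right hl
    have h1 : N 0 / 2 * (s⁻¹ ^ 2 / 2) ≤ ∫ r in (0 : ℝ)..s⁻¹, r * N r := by
      have e1 : N 0 / 2 * (s⁻¹ ^ 2 / 2) = ∫ r in (0 : ℝ)..s⁻¹, N 0 / 2 * r := by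
        rw [intervalIntegral.integral_const_mul, integral_id]
        ring
      rw [e1]
      refine intervalIntegral.integral_mono_on hr₀.1
        (Continuous.intervalIntegrable (by fun_prop) _ _)
        (hint 0 s⁻¹ (by simp) hr₀') fun r hr => ?_
      rw [mul_comm]
      exact mul_le_mul_of_nonneg_left (hnear r hr) hr.1
    have h2 := hsplit s⁻¹ hr₀'
    have h3 := hI1 s⁻¹ hr₀'
    have h4 : N 0 ≤ 8 * κ * ∫ r in (0 : ℝ)..(1 / 2), r * N r := by
      rw [inv_pow, hs2, hp, hm'] at h1
      have h5 : N 0 / 2 * ((2 * (κ * 1))⁻¹ / 2) = N 0 / (8 * κ) := by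
        field_simp
        norm_num
      rw [h5, div_le_iff₀ (by positivity)] at h1
      nlinarith
    refine h4.trans (mul_le_mul_of_nonneg_right ?_ (hI0 _ (by simp)))
    rw [hm', Real.sqrt_one, mul_one]
    have : 1 ≤ √(2 * κ) := Real.le_sqrt_of_sq_le (by linarith)
    nlinarith
  · have hm' : m = l.re := max_eq_left hl
    have hpos : 0 ≤ l.re := by linarith
    have hE : ∀ r ∈ Set.Ioo (1 / 4 : ℝ) (1 / 2), 2 * m * (s⁻¹ * N 0) ≤
        RadialSystem.energy (fun r => (radialPotential k l r).re) (fun r => (M r).re)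
          (fun r => (M r).im) (fun r => (L r).re) (fun r => (L r).im) r := by
      intro r hr
      refine le_trans ?_ (h.le_energy (p₀ := 4 * l.re) (r₀ := s⁻¹) (r := r) (by linarith)
        (fun r hr => hasDerivAt_radialPotential_re k l hr) ?_
        (fun r hr => le_radialPotential_re k hpos hr) (fun r hr =>
          h.im_mul_nonneg (fun r _ => radialPotential_im k l r) (fun r _ => by positivity) hr)
        (by positivity) (hr₀.2.trans hr.1.le) hr.2)
      · have h1 := hnear s⁻¹ ⟨hr₀.1, le_rfl⟩
        rw [hm']
        have h2 : s⁻¹ * (N 0 / 2) ≤ s⁻¹ * N s⁻¹ := mul_le_mul_of_nonneg_left h1 hr₀.1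
        have h3 := mul_le_mul_of_nonneg_left h2 (show 0 ≤ 4 * l.re by linarith)
        simp only [hN] at h3 ⊢
        linarith
      · intro r hr
        have h1 := three_fourths_lt_one_sub_sq hr
        have h2 : 0 < r := hr.1
        have h3 : 0 < 1 - r ^ 2 := by linarith
        positivity
    have h1 := h.energy_le_integral (p := p) (by linarith) hPp hE
    have h2 := hsplit (1 / 4) (by norm_num)
    have h3 := hI0 (1 / 4) (by norm_num)
    have h5 : 2 * m * (s⁻¹ * N 0) ≤ 15360 * p * ∫ r in (0 : ℝ)..(1 / 2), r * N r := by
      refine h1.trans (mul_le_mul_of_nonneg_left ?_ (by positivity))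
      change (∫ r in (1 / 4 : ℝ)..(1 / 2), r * N r) ≤ _
      linarith
    set I := ∫ r in (0 : ℝ)..(1 / 2), r * N r
    have h6 : N 0 = (2 * m * (s⁻¹ * N 0)) * (s / (2 * m)) := by
      field_simp
    calc N 0 = (2 * m * (s⁻¹ * N 0)) * (s / (2 * m)) := h6
      _ ≤ (15360 * p * I) * (s / (2 * m)) := mul_le_mul_of_nonneg_right h5 (by positivity)
      _ = 7680 * κ * √(2 * κ) * √m * I := by
        rw [hsm, hp]
        field_simp
        ring

/-! ### Polar coordinates in the disc model -/

section disc

/-- The conformal map of the unit disc onto the upper half-plane that sends `0` to `z`. -/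
def discMap (z : ℍ) (w : ℂ) : ℂ := z.re + z.im * (Complex.I * (1 + w) / (1 - w))

/-- The Euler field `w ∂/∂w` of the disc, carried to the half-plane by `discMap z`. -/
def discField (z : ℍ) (w : ℂ) : ℂ := 2 * Complex.I * z.im * w / (1 - w) ^ 2

/-- The factor that turns weight-`k` functions of the half-plane into functions on the disc for
which the equation `Δ_k f + l f = 0` is invariant under rotations. -/
def discFactor (k : ℤ) (w : ℂ) : ℂ := ((1 - conj w) / (1 - w)) ^ k

variable {z : ℍ} {k : ℤ} {F : ℂ → ℂ} {w v : ℂ} {c : ℝ → ℂ} {s : ℝ}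

theorem one_sub_ne_zero_of_norm_lt_one (hw : ‖w‖ < 1) : 1 - w ≠ 0 := by
  intro h
  rw [sub_eq_zero] at h
  simp [← h] at hw

theorem one_sub_conj_ne_zero_of_norm_lt_one (hw : ‖w‖ < 1) : 1 - conj w ≠ 0 :=
  one_sub_ne_zero_of_norm_lt_one (by simpa using hw)

theorem ofReal_im_discMap (hw : ‖w‖ < 1) : ((discMap z w).im : ℂ) =
    z.im * (1 - w * conj w) / ((1 - w) * (1 - conj w)) := by
  have h1 := one_sub_ne_zero_of_norm_lt_one hw
  have h2 := one_sub_conj_ne_zero_of_norm_lt_one hw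
  rw [Complex.im_eq_sub_conj, discMap]
  simp only [map_add, map_mul, map_div₀, map_sub, map_one, Complex.conj_ofReal, Complex.conj_I]
  field_simp
  ring

theorem im_discMap (hw : ‖w‖ < 1) : (discMap z w).im =
    z.im * (1 - ‖w‖ ^ 2) / ‖1 - w‖ ^ 2 := by
  have h := ofReal_im_discMap (z := z) hw
  have h3 : 1 - conj w = conj (1 - w) := by simp
  rw [h3, Complex.mul_conj, Complex.mul_conj, Complex.normSq_eq_norm_sq,
    Complex.normSq_eq_norm_sq] at h
  exact_mod_cast h

theorem im_discMap_pos (hw : ‖w‖ < 1) : 0 < (discMap z w).im := by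
  rw [im_discMap hw]
  have h1 : 0 < ‖1 - w‖ := norm_pos_iff.mpr (one_sub_ne_zero_of_norm_lt_one hw)
  have h2 : 0 < 1 - ‖w‖ ^ 2 := by nlinarith [norm_nonneg w]
  have h3 := z.im_pos
  positivity

theorem hasDerivAt_discMap (hw : ‖w‖ < 1) :
    HasDerivAt (discMap z) (2 * Complex.I * z.im / (1 - w) ^ 2) w := by
  have h1 := one_sub_ne_zero_of_norm_lt_one hw
  unfold discMap
  convert! (((((hasDerivAt_id w).const_add 1).const_mul Complex.I).div
    ((hasDerivAt_id w).const_sub 1) h1).const_mul (z.im : ℂ)).const_add (z.re : ℂ) using 1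
  simp only [id]
  field_simp
  ring

theorem isOpen_im_pos : IsOpen {w : ℂ | 0 < w.im} :=
  isOpen_lt continuous_const Complex.continuous_im

theorem contDiffAt_of_im_pos (hF : ContDiffOn ℝ 2 F {w : ℂ | 0 < w.im}) (hw : 0 < w.im) :
    ContDiffAt ℝ 2 F w := hF.contDiffAt (isOpen_im_pos.mem_nhds hw)

theorem hasFDerivAt_of_im_pos (hF : ContDiffOn ℝ 2 F {w : ℂ | 0 < w.im}) (hw : 0 < w.im) :
    HasFDerivAt F (fderiv ℝ F w) w :=
  ((contDiffAt_of_im_pos hF hw).differentiableAt (by norm_num)).hasFDerivAt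

theorem hasFDerivAt_fderiv_of_im_pos (hF : ContDiffOn ℝ 2 F {w : ℂ | 0 < w.im}) (hw : 0 < w.im) :
    HasFDerivAt (fderiv ℝ F) (fderiv ℝ (fderiv ℝ F) w) w :=
  (((contDiffAt_of_im_pos hF hw).fderiv_right (m := 1) (by norm_num)).differentiableAt
    (by norm_num)).hasFDerivAt

theorem hasDerivAt_conj_comp (hc : HasDerivAt c v s) :
    HasDerivAt (fun x => conj (c x)) (conj v) s :=
  Complex.conjCLE.toContinuousLinearMap.hasFDerivAt.comp_hasDerivAt s hc

theorem hasDerivAt_discMap_comp (hw : ‖c s‖ < 1) (hc : HasDerivAt c v s) :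
    HasDerivAt (fun x => discMap z (c x)) (2 * Complex.I * z.im / (1 - c s) ^ 2 * v) s := by
  have h := (hasDerivAt_discMap (z := z) hw).scomp s hc
  rw [smul_eq_mul, mul_comm] at h
  exact h

theorem hasDerivAt_comp_discMap (hF : ContDiffOn ℝ 2 F {w : ℂ | 0 < w.im}) (hw : ‖c s‖ < 1)
    (hc : HasDerivAt c v s) : HasDerivAt (fun x => F (discMap z (c x)))
      (fderiv ℝ F (discMap z (c s)) (2 * Complex.I * z.im / (1 - c s) ^ 2 * v)) s :=
  (hasFDerivAt_of_im_pos hF (im_discMap_pos hw)).comp_hasDerivAt s (hasDerivAt_discMap_comp hw hc)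

theorem hasDerivAt_fderiv_comp_discMap (hF : ContDiffOn ℝ 2 F {w : ℂ | 0 < w.im}) (hw : ‖c s‖ < 1)
    (hc : HasDerivAt c v s) {X : ℝ → ℂ} {X' : ℂ} (hX : HasDerivAt X X' s) :
    HasDerivAt (fun x => fderiv ℝ F (discMap z (c x)) (X x))
      (fderiv ℝ (fderiv ℝ F) (discMap z (c s)) (2 * Complex.I * z.im / (1 - c s) ^ 2 * v) (X s) +
        fderiv ℝ F (discMap z (c s)) X') s := by
  have h1 := hasFDerivAt_fderiv_of_im_pos hF (im_discMap_pos (z := z) hw)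
  have h2 : HasDerivAt (fun x => fderiv ℝ F (discMap z (c x))) _ s :=
    h1.comp_hasDerivAt s (hasDerivAt_discMap_comp hw hc)
  exact h2.clm_apply hX

theorem hasDerivAt_discFactor_comp (hw : ‖c s‖ < 1) (hc : HasDerivAt c v s) :
    HasDerivAt (fun x => discFactor k (c x))
      (discFactor k (c s) * (k * (v / (1 - c s) - conj v / (1 - conj (c s))))) s := by
  have h1 := one_sub_ne_zero_of_norm_lt_one hw
  have h2 := one_sub_conj_ne_zero_of_norm_lt_one hw
  have h3 : (1 - conj (c s)) / (1 - c s) ≠ 0 := div_ne_zero h2 h1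
  have hu := ((hasDerivAt_conj_comp hc).const_sub 1).div (hc.const_sub 1) h1
  convert! (hasDerivAt_zpow k _ (Or.inl h3)).scomp s hu using 1
  rw [smul_eq_mul, zpow_sub_one₀ h3, discFactor]
  field_simp
  ring

theorem hasDerivAt_discField_comp (hw : ‖c s‖ < 1) (hc : HasDerivAt c v s) :
    HasDerivAt (fun x => discField z (c x))
      (2 * Complex.I * z.im * (1 + c s) / (1 - c s) ^ 3 * v) s := by
  have h1 := one_sub_ne_zero_of_norm_lt_one hw
  unfold discField
  convert! (hc.const_mul (2 * Complex.I * (z.im : ℂ))).div ((hc.const_sub 1).pow 2)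
    (pow_ne_zero 2 h1) using 1
  simp only [Pi.pow_apply]
  field_simp
  ring

theorem hasDerivAt_div_one_sub_comp (hw : ‖c s‖ < 1) (hc : HasDerivAt c v s) :
    HasDerivAt (fun x => c x / (1 - c x)) (v / (1 - c s) ^ 2) s := by
  have h1 := one_sub_ne_zero_of_norm_lt_one hw
  convert! hc.div (hc.const_sub 1) h1 using 1
  field_simp
  ring

theorem hasDerivAt_conj_div_one_sub_comp (hw : ‖c s‖ < 1) (hc : HasDerivAt c v s) :
    HasDerivAt (fun x => conj (c x) / (1 - conj (c x))) (conj v / (1 - conj (c s)) ^ 2) s :=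
  hasDerivAt_div_one_sub_comp (by simpa using hw) (hasDerivAt_conj_comp hc)

/-- The function on the disc that corresponds to the function `F` of weight `k` on the half-plane
`{Im > 0}` of `ℂ`. -/
def discPull (z : ℍ) (k : ℤ) (F : ℂ → ℂ) (w : ℂ) : ℂ := discFactor k w * F (discMap z w)

/-- The radial derivative `r ∂/∂r` of `discPull z k F`. -/
def discRad (z : ℍ) (k : ℤ) (F : ℂ → ℂ) (w : ℂ) : ℂ :=
  discFactor k w * (k * (w / (1 - w) - conj w / (1 - conj w)) * F (discMap z w) +
    fderiv ℝ F (discMap z w) (discField z w))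

/-- The angular derivative `∂/∂θ` of `discPull z k F`. -/
def discAng (z : ℍ) (k : ℤ) (F : ℂ → ℂ) (w : ℂ) : ℂ :=
  discFactor k w * (Complex.I * k * (w / (1 - w) + conj w / (1 - conj w)) * F (discMap z w) +
    fderiv ℝ F (discMap z w) (Complex.I * discField z w))

/-- The second radial derivative `(r ∂/∂r)²` of `discPull z k F`. -/
def discRad₂ (z : ℍ) (k : ℤ) (F : ℂ → ℂ) (w : ℂ) : ℂ :=
  discFactor k w * (k * (w / (1 - w) - conj w / (1 - conj w))) *
    (k * (w / (1 - w) - conj w / (1 - conj w)) * F (discMap z w) +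
      fderiv ℝ F (discMap z w) (discField z w)) +
  discFactor k w * (k * (w / (1 - w) ^ 2 - conj w / (1 - conj w) ^ 2) * F (discMap z w) +
    k * (w / (1 - w) - conj w / (1 - conj w)) * fderiv ℝ F (discMap z w) (discField z w) +
    (fderiv ℝ (fderiv ℝ F) (discMap z w) (discField z w) (discField z w) +
      fderiv ℝ F (discMap z w) (2 * Complex.I * z.im * (1 + w) / (1 - w) ^ 3 * w)))

/-- The second angular derivative `∂²/∂θ²` of `discPull z k F`. -/
def discAng₂ (z : ℍ) (k : ℤ) (F : ℂ → ℂ) (w : ℂ) : ℂ :=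
  discFactor k w * (Complex.I * k * (w / (1 - w) + conj w / (1 - conj w))) *
    (Complex.I * k * (w / (1 - w) + conj w / (1 - conj w)) * F (discMap z w) +
      fderiv ℝ F (discMap z w) (Complex.I * discField z w)) +
  discFactor k w * (-k * (w / (1 - w) ^ 2 - conj w / (1 - conj w) ^ 2) * F (discMap z w) +
    Complex.I * k * (w / (1 - w) + conj w / (1 - conj w)) *
      fderiv ℝ F (discMap z w) (Complex.I * discField z w) +
    (fderiv ℝ (fderiv ℝ F) (discMap z w) (Complex.I * discField z w) (Complex.I * discField z w) +
      fderiv ℝ F (discMap z w) (-(2 * Complex.I * z.im * (1 + w) / (1 - w) ^ 3 * w))))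

theorem hasDerivAt_polar_radius (r θ : ℝ) (hr : r ≠ 0) :
    HasDerivAt (fun x : ℝ => circleMap 0 x θ) ((r⁻¹ : ℝ) * circleMap 0 r θ) r := by
  have hr' : (r : ℂ) ≠ 0 := by exact_mod_cast hr
  have h := (Complex.ofRealCLM.hasDerivAt (x := r)).mul_const (Complex.exp (θ * Complex.I))
  simp only [circleMap_zero]
  convert! h using 1
  push_cast
  simp
  field_simp

theorem norm_circleMap_lt_one {r : ℝ} (θ : ℝ) (hr : r ∈ Set.Ioo (-1 : ℝ) 1) :
    ‖circleMap 0 r θ‖ < 1 := by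
  rw [norm_circleMap_zero]
  exact abs_lt.mpr hr

theorem fderiv_ofReal_mul (A : ℂ →L[ℝ] ℂ) (t : ℝ) (x : ℂ) : A (t * x) = t * A x := by
  simpa using A.map_smul t x

theorem hasDerivAt_discPull_of_real (hF : ContDiffOn ℝ 2 F {w : ℂ | 0 < w.im}) {t : ℝ}
    (hw : ‖c s‖ < 1) (hc : HasDerivAt c (t * c s) s) :
    HasDerivAt (fun x : ℝ => discPull z k F (c x))
      ((t : ℂ) * discRad z k F (c s)) s := by
  unfold discPull
  convert! (hasDerivAt_discFactor_comp (k := k) hw hc).mul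
    (hasDerivAt_comp_discMap (z := z) hF hw hc) using 1
  set w := c s
  have e : 2 * Complex.I * z.im / (1 - w) ^ 2 * ((t : ℂ) * w) = (t : ℂ) * discField z w := by
    unfold discField; ring
  rw [e, fderiv_ofReal_mul, map_mul, Complex.conj_ofReal, discRad]
  ring

theorem hasDerivAt_discRad_of_real (hF : ContDiffOn ℝ 2 F {w : ℂ | 0 < w.im}) {t : ℝ}
    (hw : ‖c s‖ < 1) (hc : HasDerivAt c (t * c s) s) :
    HasDerivAt (fun x : ℝ => discRad z k F (c x))
      ((t : ℂ) * discRad₂ z k F (c s)) s := by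
  unfold discRad
  convert! (hasDerivAt_discFactor_comp (k := k) hw hc).mul
    (((((hasDerivAt_div_one_sub_comp hw hc).sub (hasDerivAt_conj_div_one_sub_comp hw hc)).const_mul
      (k : ℂ)).mul (hasDerivAt_comp_discMap (z := z) hF hw hc)).add
      (hasDerivAt_fderiv_comp_discMap (z := z) hF hw hc
        (hasDerivAt_discField_comp (z := z) hw hc))) using 1
  set w := c s
  have e : 2 * Complex.I * z.im / (1 - w) ^ 2 * ((t : ℂ) * w) = (t : ℂ) * discField z w := by
    unfold discField; ring
  have e' : 2 * Complex.I * z.im * (1 + w) / (1 - w) ^ 3 * ((t : ℂ) * w) =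
      (t : ℂ) * (2 * Complex.I * z.im * (1 + w) / (1 - w) ^ 3 * w) := by ring
  have e2 : ∀ x y : ℂ, fderiv ℝ (fderiv ℝ F) (discMap z w) ((t : ℂ) * x) y =
      (t : ℂ) * fderiv ℝ (fderiv ℝ F) (discMap z w) x y := fun x y => by
    have := congrArg (fun T => T y) ((fderiv ℝ (fderiv ℝ F) (discMap z w)).map_smul t x)
    simpa using this
  simp only [Pi.mul_apply, Pi.sub_apply, Pi.add_apply]
  rw [e, e', fderiv_ofReal_mul, fderiv_ofReal_mul, e2, map_mul, Complex.conj_ofReal, discRad₂]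
  ring

theorem hasDerivAt_discPull_angle (hF : ContDiffOn ℝ 2 F {w : ℂ | 0 < w.im}) {r : ℝ} (θ : ℝ)
    (hr : r ∈ Set.Ioo (-1 : ℝ) 1) :
    HasDerivAt (fun x : ℝ => discPull z k F (circleMap 0 r x))
      (discAng z k F (circleMap 0 r θ)) θ := by
  have hw := norm_circleMap_lt_one θ hr
  have hc := hasDerivAt_circleMap 0 r θ
  unfold discPull
  convert! (hasDerivAt_discFactor_comp (k := k) hw hc).mul
    (hasDerivAt_comp_discMap (z := z) hF hw hc) using 1
  set w := circleMap 0 r θ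
  have e : 2 * Complex.I * z.im / (1 - w) ^ 2 * (w * Complex.I) = Complex.I * discField z w := by
    unfold discField; ring
  rw [e, map_mul, Complex.conj_I, discAng]
  ring

theorem hasDerivAt_discAng_angle (hF : ContDiffOn ℝ 2 F {w : ℂ | 0 < w.im}) {r : ℝ} (θ : ℝ)
    (hr : r ∈ Set.Ioo (-1 : ℝ) 1) :
    HasDerivAt (fun x : ℝ => discAng z k F (circleMap 0 r x))
      (discAng₂ z k F (circleMap 0 r θ)) θ := by
  have hw := norm_circleMap_lt_one θ hr
  have hc := hasDerivAt_circleMap 0 r θ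
  unfold discAng
  convert! (hasDerivAt_discFactor_comp (k := k) hw hc).mul
    (((((hasDerivAt_div_one_sub_comp hw hc).add (hasDerivAt_conj_div_one_sub_comp hw hc)).const_mul
      (Complex.I * k : ℂ)).mul (hasDerivAt_comp_discMap (z := z) hF hw hc)).add
      (hasDerivAt_fderiv_comp_discMap (z := z) hF hw hc
        ((hasDerivAt_discField_comp (z := z) hw hc).const_mul Complex.I))) using 1
  set w := circleMap 0 r θ
  have e : 2 * Complex.I * z.im / (1 - w) ^ 2 * (w * Complex.I) = Complex.I * discField z w := by
    unfold discField; ring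
  have e' : Complex.I * (2 * Complex.I * z.im * (1 + w) / (1 - w) ^ 3 * (w * Complex.I)) =
      -(2 * Complex.I * z.im * (1 + w) / (1 - w) ^ 3 * w) := by
    linear_combination (2 * Complex.I * z.im * (1 + w) / (1 - w) ^ 3 * w) * Complex.I_sq
  simp only [Pi.mul_apply, Pi.add_apply]
  rw [e, e', map_mul, Complex.conj_I, discAng₂]
  linear_combination (-discFactor k w * k * (w / (1 - w) ^ 2 - conj w / (1 - conj w) ^ 2) *
    F (discMap z w)) * Complex.I_sq

theorem clm_apply_eq (A : ℂ →L[ℝ] ℂ) (x : ℂ) : A x = x.re * A 1 + x.im * A Complex.I := by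
  conv_lhs => rw [← Complex.re_add_im x]
  rw [map_add, fderiv_ofReal_mul]
  congr 1
  · simpa using fderiv_ofReal_mul A x.re 1

/-- The trace of a symmetric bilinear form in the conformal frame `X, i X`. -/
theorem clm_apply_add_apply_I (B : ℂ →L[ℝ] ℂ →L[ℝ] ℂ) (hB : B 1 Complex.I = B Complex.I 1)
    (x : ℂ) : B x x + B (Complex.I * x) (Complex.I * x) =
      x * conj x * (B 1 1 + B Complex.I Complex.I) := by
  have h : ∀ x y : ℂ, B x y = x.re * (y.re * B 1 1 + y.im * B 1 Complex.I) +
      x.im * (y.re * B Complex.I 1 + y.im * B Complex.I Complex.I) := fun x y => by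
    have h1 := clm_apply_eq (B.flip y) x
    simp only [ContinuousLinearMap.flip_apply] at h1
    rw [h1, clm_apply_eq (B 1) y, clm_apply_eq (B Complex.I) y]
  rw [h x x, h (Complex.I * x), hB, Complex.mul_conj, Complex.normSq_apply]
  simp
  ring

/-- The equation `Δ_k F + l F = 0` in polar coordinates of the disc. -/
theorem discRad₂_add_discAng₂ (hF : ContDiffOn ℝ 2 F {w : ℂ | 0 < w.im}) {l : ℂ}
    (heq : ∀ p : ℂ, 0 < p.im → (p.im : ℂ) ^ 2 * (fderiv ℝ (fderiv ℝ F) p 1 1 +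
      fderiv ℝ (fderiv ℝ F) p Complex.I Complex.I) - 2 * Complex.I * k * p.im * fderiv ℝ F p 1 +
      l * F p = 0) (hw : ‖w‖ < 1) :
    discRad₂ z k F w + discAng₂ z k F w +
      (w * conj w) * (4 * l / (1 - w * conj w) ^ 2 + 4 * k ^ 2 / (1 - w * conj w)) *
        discPull z k F w -
      4 * Complex.I * k * (w * conj w) / (1 - w * conj w) * discAng z k F w = 0 := by
  have h1 := one_sub_ne_zero_of_norm_lt_one hw
  have h2 := one_sub_conj_ne_zero_of_norm_lt_one hw
  have hp := im_discMap_pos (z := z) hw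
  have h3 : 1 - w * conj w ≠ 0 := by
    rw [Complex.mul_conj, Complex.normSq_eq_norm_sq]
    have : (1 : ℝ) - ‖w‖ ^ 2 ≠ 0 := by nlinarith [norm_nonneg w]
    exact_mod_cast this
  have he := heq _ hp
  have hsymm : fderiv ℝ (fderiv ℝ F) (discMap z w) 1 Complex.I =
      fderiv ℝ (fderiv ℝ F) (discMap z w) Complex.I 1 :=
    ((contDiffAt_of_im_pos hF hp).isSymmSndFDerivAt (by simp)) 1 Complex.I
  have htr := clm_apply_add_apply_I _ hsymm (discField z w)
  have hX := clm_apply_eq (fderiv ℝ F (discMap z w)) (discField z w)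
  have hIX := clm_apply_eq (fderiv ℝ F (discMap z w)) (Complex.I * discField z w)
  rw [Complex.re_eq_add_conj, Complex.im_eq_sub_conj] at hX hIX
  have hconj : conj (discField z w) =
      -(2 * Complex.I * z.im * conj w / (1 - conj w) ^ 2) := by
    simp only [discField, map_div₀, map_mul, map_ofNat, Complex.conj_I, Complex.conj_ofReal,
      map_pow, map_sub, map_one]
    ring
  have hconjI : conj (Complex.I * discField z w) = -(Complex.I * conj (discField z w)) := by
    rw [map_mul, Complex.conj_I, neg_mul]
  rw [hconjI, hconj] at hIX
  rw [hconj] at htr hX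
  rw [ofReal_im_discMap hw] at he
  unfold discRad₂ discAng₂ discPull discAng
  rw [map_neg]
  -- From here on this is an identity of rational functions, with `w` and its conjugate `u` treated
  -- as independent variables.
  generalize fderiv ℝ F (discMap z w) (2 * Complex.I * z.im * (1 + w) / (1 - w) ^ 3 * w) = d at *
  generalize fderiv ℝ F (discMap z w) (Complex.I * discField z w) = dI at *
  generalize fderiv ℝ F (discMap z w) (discField z w) = dX at *
  generalize fderiv ℝ (fderiv ℝ F) (discMap z w) (Complex.I * discField z w)
    (Complex.I * discField z w) = bI at *
  generalize fderiv ℝ (fderiv ℝ F) (discMap z w) (discField z w) (discField z w) = bX at *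
  generalize fderiv ℝ (fderiv ℝ F) (discMap z w) 1 1 +
    fderiv ℝ (fderiv ℝ F) (discMap z w) Complex.I Complex.I = S at *
  generalize fderiv ℝ F (discMap z w) 1 = fx at *
  generalize fderiv ℝ F (discMap z w) Complex.I = fy at *
  generalize F (discMap z w) = f₀ at *
  generalize discFactor k w = E at *
  have hI := Complex.I_ne_zero
  have hI2 := Complex.I_sq
  unfold discField at htr hX hIX
  generalize conj w = u at *
  generalize (z.im : ℂ) = y at *
  generalize Complex.I = i at *
  generalize (k : ℂ) = K at *
  have hX' : dX = i * y * (w / (1 - w) ^ 2 - u / (1 - u) ^ 2) * fx +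
      y * (w / (1 - w) ^ 2 + u / (1 - u) ^ 2) * fy := by
    rw [hX]
    field_simp
    ring
  have hIX' : dI = -y * (w / (1 - w) ^ 2 + u / (1 - u) ^ 2) * fx +
      i * y * (w / (1 - w) ^ 2 - u / (1 - u) ^ 2) * fy := by
    rw [hIX]
    field_simp
    linear_combination (y * (w * (1 - u) ^ 2 + u * (1 - w) ^ 2) * fx) * hI2
  have hbI : bI = 4 * y ^ 2 * w * u / ((1 - w) * (1 - u)) ^ 2 * S - bX := by
    rw [eq_sub_iff_add_eq', htr]
    field_simp
    linear_combination (-4 * y ^ 2 * w * u * S) * hI2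
  have e : 1 - w * u ≠ 0 := h3
  rw [hX', hIX', hbI]
  trans E * (4 * w * u / (1 - w * u) ^ 2) * ((y * (1 - w * u) / ((1 - w) * (1 - u))) ^ 2 * S -
      2 * i * K * (y * (1 - w * u) / ((1 - w) * (1 - u))) * fx + l * f₀) +
    (E * K ^ 2 * (w / (1 - w) + u / (1 - u)) ^ 2 * f₀ -
      4 * K ^ 2 * (w * u) / (1 - w * u) * (w / (1 - w) + u / (1 - u)) * f₀ * E +
      K * y * (w / (1 - w) ^ 2 - u / (1 - u) ^ 2) * fy * E *
        (2 * (w / (1 - w) + u / (1 - u)) - 4 * (w * u) / (1 - w * u))) * (i ^ 2 + 1)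
  · field_simp
    ring
  · rw [he, hI2]
    ring

end disc

/-! ### Angular means of eigenfunctions -/

section mean

variable {z : ℍ} {k : ℤ} {F : ℂ → ℂ} {l : ℂ}

theorem norm_lt_one_of_mem_ball {w : ℂ} (hw : w ∈ Metric.ball (0 : ℂ) 1) : ‖w‖ < 1 := by
  simpa using hw

theorem continuousOn_discMap : ContinuousOn (discMap z) (Metric.ball 0 1) := fun _ hw =>
  (hasDerivAt_discMap (norm_lt_one_of_mem_ball hw)).continuousAt.continuousWithinAt

theorem mapsTo_discMap : Set.MapsTo (discMap z) (Metric.ball 0 1) {w : ℂ | 0 < w.im} := fun _ hw =>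
  im_discMap_pos (norm_lt_one_of_mem_ball hw)

theorem continuousOn_discField : ContinuousOn (discField z) (Metric.ball 0 1) := by
  unfold discField
  exact ContinuousOn.div (by fun_prop) (by fun_prop) fun w hw =>
    pow_ne_zero 2 (one_sub_ne_zero_of_norm_lt_one (norm_lt_one_of_mem_ball hw))

theorem continuousOn_discFactor : ContinuousOn (discFactor k) (Metric.ball 0 1) := by
  unfold discFactor
  refine ContinuousOn.zpow₀ (ContinuousOn.div (by fun_prop) (by fun_prop) fun w hw => ?_) k
    fun w hw => Or.inl (div_ne_zero ?_ ?_)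
  · exact one_sub_ne_zero_of_norm_lt_one (norm_lt_one_of_mem_ball hw)
  · exact one_sub_conj_ne_zero_of_norm_lt_one (norm_lt_one_of_mem_ball hw)
  · exact one_sub_ne_zero_of_norm_lt_one (norm_lt_one_of_mem_ball hw)

theorem continuousOn_fderiv (hF : ContDiffOn ℝ 2 F {w : ℂ | 0 < w.im}) :
    ContinuousOn (fderiv ℝ F) {w : ℂ | 0 < w.im} := fun _ hw =>
  (hasFDerivAt_fderiv_of_im_pos hF hw).continuousAt.continuousWithinAt

theorem continuousOn_fderiv_fderiv (hF : ContDiffOn ℝ 2 F {w : ℂ | 0 < w.im}) :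
    ContinuousOn (fderiv ℝ (fderiv ℝ F)) {w : ℂ | 0 < w.im} :=
  (hF.fderiv_of_isOpen isOpen_im_pos (m := 1) (by norm_num)).continuousOn_fderiv_of_isOpen
    isOpen_im_pos (by norm_num)

theorem continuousOn_discPull (hF : ContDiffOn ℝ 2 F {w : ℂ | 0 < w.im}) :
    ContinuousOn (discPull z k F) (Metric.ball 0 1) :=
  continuousOn_discFactor.mul (hF.continuousOn.comp continuousOn_discMap mapsTo_discMap)

theorem continuousOn_div_one_sub :
    ContinuousOn (fun w : ℂ => w / (1 - w)) (Metric.ball 0 1) :=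
  ContinuousOn.div (by fun_prop) (by fun_prop) fun _ hw =>
    one_sub_ne_zero_of_norm_lt_one (norm_lt_one_of_mem_ball hw)

theorem continuousOn_conj_div_one_sub :
    ContinuousOn (fun w : ℂ => conj w / (1 - conj w)) (Metric.ball 0 1) :=
  ContinuousOn.div (by fun_prop) (by fun_prop) fun _ hw =>
    one_sub_conj_ne_zero_of_norm_lt_one (norm_lt_one_of_mem_ball hw)

theorem continuousOn_div_one_sub_sq :
    ContinuousOn (fun w : ℂ => w / (1 - w) ^ 2) (Metric.ball 0 1) :=
  ContinuousOn.div (by fun_prop) (by fun_prop) fun _ hw =>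
    pow_ne_zero 2 (one_sub_ne_zero_of_norm_lt_one (norm_lt_one_of_mem_ball hw))

theorem continuousOn_conj_div_one_sub_sq :
    ContinuousOn (fun w : ℂ => conj w / (1 - conj w) ^ 2) (Metric.ball 0 1) :=
  ContinuousOn.div (by fun_prop) (by fun_prop) fun _ hw =>
    pow_ne_zero 2 (one_sub_conj_ne_zero_of_norm_lt_one (norm_lt_one_of_mem_ball hw))

theorem continuousOn_discField_deriv : ContinuousOn
    (fun w => 2 * Complex.I * z.im * (1 + w) / (1 - w) ^ 3 * w) (Metric.ball 0 1) :=
  (ContinuousOn.div (by fun_prop) (by fun_prop) fun _ hw =>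
    pow_ne_zero 3 (one_sub_ne_zero_of_norm_lt_one (norm_lt_one_of_mem_ball hw))).mul (by fun_prop)

theorem continuousOn_discRad (hF : ContDiffOn ℝ 2 F {w : ℂ | 0 < w.im}) :
    ContinuousOn (discRad z k F) (Metric.ball 0 1) := by
  have h1 := hF.continuousOn.comp continuousOn_discMap (mapsTo_discMap (z := z))
  have h2 := (continuousOn_fderiv hF).comp continuousOn_discMap (mapsTo_discMap (z := z))
  exact continuousOn_discFactor.mul (((continuousOn_const.mul (continuousOn_div_one_sub.sub
    continuousOn_conj_div_one_sub)).mul h1).add (h2.clm_apply continuousOn_discField))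

theorem continuousOn_discAng (hF : ContDiffOn ℝ 2 F {w : ℂ | 0 < w.im}) :
    ContinuousOn (discAng z k F) (Metric.ball 0 1) := by
  have h1 := hF.continuousOn.comp continuousOn_discMap (mapsTo_discMap (z := z))
  have h2 := (continuousOn_fderiv hF).comp continuousOn_discMap (mapsTo_discMap (z := z))
  exact continuousOn_discFactor.mul (((continuousOn_const.mul (continuousOn_div_one_sub.add
    continuousOn_conj_div_one_sub)).mul h1).add
    (h2.clm_apply (continuousOn_const.mul continuousOn_discField)))

theorem continuousOn_discRad₂ (hF : ContDiffOn ℝ 2 F {w : ℂ | 0 < w.im}) :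
    ContinuousOn (discRad₂ z k F) (Metric.ball 0 1) := by
  have h1 := hF.continuousOn.comp continuousOn_discMap (mapsTo_discMap (z := z))
  have h2 := (continuousOn_fderiv hF).comp continuousOn_discMap (mapsTo_discMap (z := z))
  have h3 := (continuousOn_fderiv_fderiv hF).comp continuousOn_discMap (mapsTo_discMap (z := z))
  have h4 := h2.clm_apply (continuousOn_discField (z := z))
  have h5 : ContinuousOn (fun w : ℂ => (k : ℂ) * (w / (1 - w) - conj w / (1 - conj w)))
    (Metric.ball 0 1) :=
    continuousOn_const.mul (continuousOn_div_one_sub.sub continuousOn_conj_div_one_sub)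
  exact ((continuousOn_discFactor.mul h5).mul ((h5.mul h1).add h4)).add
    (continuousOn_discFactor.mul ((((continuousOn_const.mul (continuousOn_div_one_sub_sq.sub
      continuousOn_conj_div_one_sub_sq)).mul h1).add (h5.mul h4)).add
      (((h3.clm_apply continuousOn_discField).clm_apply continuousOn_discField).add
        (h2.clm_apply continuousOn_discField_deriv))))

theorem continuousOn_discAng₂ (hF : ContDiffOn ℝ 2 F {w : ℂ | 0 < w.im}) :
    ContinuousOn (discAng₂ z k F) (Metric.ball 0 1) := by
  have h1 := hF.continuousOn.comp continuousOn_discMap (mapsTo_discMap (z := z))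
  have h2 := (continuousOn_fderiv hF).comp continuousOn_discMap (mapsTo_discMap (z := z))
  have h3 := (continuousOn_fderiv_fderiv hF).comp continuousOn_discMap (mapsTo_discMap (z := z))
  have h6 : ContinuousOn (fun w => Complex.I * discField z w) (Metric.ball 0 1) :=
    continuousOn_const.mul continuousOn_discField
  have h4 := h2.clm_apply h6
  have h5 : ContinuousOn (fun w : ℂ => Complex.I * k * (w / (1 - w) + conj w / (1 - conj w)))
    (Metric.ball 0 1) :=
    continuousOn_const.mul (continuousOn_div_one_sub.add continuousOn_conj_div_one_sub)
  exact ((continuousOn_discFactor.mul h5).mul ((h5.mul h1).add h4)).add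
    (continuousOn_discFactor.mul ((((continuousOn_const.mul (continuousOn_div_one_sub_sq.sub
      continuousOn_conj_div_one_sub_sq)).mul h1).add (h5.mul h4)).add
      (((h3.clm_apply h6).clm_apply h6).add (h2.clm_apply continuousOn_discField_deriv.neg))))

/-- The integral of `A` over the circle of radius `r` about the origin with respect to the angle,
not divided by `2 π`. -/
def angularIntegral (A : ℂ → ℂ) (r : ℝ) : ℂ := ∫ θ in -Real.pi..Real.pi, A (circleMap 0 r θ)

theorem continuous_circleMap_uncurry : Continuous fun x : ℝ × ℝ => circleMap 0 x.1 x.2 := by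
  simp only [circleMap_zero]
  fun_prop

theorem continuous_comp_circleMap {A : ℂ → ℂ} (hA : ContinuousOn A (Metric.ball 0 1)) {r : ℝ}
    (hr : r ∈ Set.Ioo (-1 : ℝ) 1) : Continuous fun θ => A (circleMap 0 r θ) :=
  hA.comp_continuous (continuous_circleMap 0 r) fun θ => by simpa using norm_circleMap_lt_one θ hr

theorem continuousOn_angularIntegral {A : ℂ → ℂ} (hA : ContinuousOn A (Metric.ball 0 1)) :
    ContinuousOn (angularIntegral A) (Set.Ioo (-1) 1) := by
  rw [continuousOn_iff_continuous_domRestrict]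
  refine intervalIntegral.continuous_parametric_intervalIntegral_of_continuous'
    (f := fun (r : Set.Ioo (-1 : ℝ) 1) θ => A (circleMap 0 r θ)) ?_ _ _
  refine hA.comp_continuous (f := fun x : Set.Ioo (-1 : ℝ) 1 × ℝ => circleMap 0 x.1 x.2)
    (continuous_circleMap_uncurry.comp
      ((continuous_subtype_val.comp continuous_fst).prodMk continuous_snd)) fun x => ?_
  simpa using norm_circleMap_lt_one x.2 x.1.2

theorem hasDerivAt_angularIntegral {A B : ℂ → ℂ} (hA : ContinuousOn A (Metric.ball 0 1))
    (hB : ContinuousOn B (Metric.ball 0 1))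
    (hAB : ∀ θ : ℝ, ∀ r ∈ Set.Ioo (0 : ℝ) 1, HasDerivAt (fun x => A (circleMap 0 x θ))
      ((r⁻¹ : ℝ) * B (circleMap 0 r θ)) r) {r : ℝ} (hr : r ∈ Set.Ioo (0 : ℝ) 1) :
    HasDerivAt (angularIntegral A) (angularIntegral B r / r) r := by
  have hsub : Set.Ioo (0 : ℝ) 1 ⊆ Set.Ioo (-1 : ℝ) 1 := Set.Ioo_subset_Ioo_left (by norm_num)
  -- `B` is bounded on a closed disc of radius `R` between `r` and `1`.
  set R := (r + 1) / 2 with hR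
  have hR1 : R < 1 := by rw [hR]; linarith [hr.2]
  have hrR : r < R := by rw [hR]; linarith [hr.2]
  obtain ⟨C, hC⟩ := (isCompact_closedBall (0 : ℂ) R).exists_bound_of_continuousOn
    (hB.mono (Metric.closedBall_subset_ball hR1))
  have hsubI : Set.Ioo (r / 2) R ⊆ Set.Ioo (0 : ℝ) 1 := fun x hx =>
    ⟨by linarith [hx.1, hr.1], hx.2.trans hR1⟩
  have hBc := continuous_comp_circleMap hB (hsub hr)
  have key := (intervalIntegral.hasDerivAt_integral_of_dominated_loc_of_deriv_le
    (μ := volume) (a := -Real.pi) (b := Real.pi) (F := fun r θ => A (circleMap 0 r θ))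
    (F' := fun r θ => ((r⁻¹ : ℝ) : ℂ) * B (circleMap 0 r θ)) (x₀ := r)
    (bound := fun _ => 2 / r * C) (s := Set.Ioo (r / 2) R)
    (Ioo_mem_nhds (by linarith [hr.1]) hrR) ?_ ?_ ?_ ?_ ?_ ?_).2
  · rw [intervalIntegral.integral_const_mul] at key
    convert! key using 1
    rw [angularIntegral]
    push_cast
    field_simp
  · filter_upwards [Ioo_mem_nhds hr.1 hr.2] with x hx
    exact (continuous_comp_circleMap hA (hsub hx)).aestronglyMeasurable
  · exact (continuous_comp_circleMap hA (hsub hr)).intervalIntegrable _ _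
  · exact (continuous_const.mul hBc).aestronglyMeasurable
  · refine Filter.Eventually.of_forall fun θ _ x hx => ?_
    have hx0 : 0 < x := (hsubI hx).1
    have h1 : ‖B (circleMap 0 x θ)‖ ≤ C := by
      refine hC _ ?_
      rw [mem_closedBall_zero_iff, norm_circleMap_zero, abs_of_pos hx0]
      exact hx.2.le
    have h2 : ‖((x⁻¹ : ℝ) : ℂ)‖ ≤ 2 / r := by
      rw [Complex.norm_real, Real.norm_of_nonneg (by positivity), inv_eq_one_div,
        div_le_div_iff₀ hx0 hr.1]
      linarith [hx.1]
    rw [norm_mul]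
    exact mul_le_mul h2 h1 (norm_nonneg _) (div_nonneg (by norm_num) hr.1.le)
  · exact intervalIntegrable_const
  · exact Filter.Eventually.of_forall fun θ _ x hx => hAB θ x (hsubI hx)

/-- An integral of a derivative over a full turn vanishes. -/
theorem angularIntegral_eq_zero {A B : ℂ → ℂ} (hB : ContinuousOn B (Metric.ball 0 1)) {r : ℝ}
    (hr : r ∈ Set.Ioo (-1 : ℝ) 1)
    (hAB : ∀ θ : ℝ, HasDerivAt (fun x => A (circleMap 0 r x)) (B (circleMap 0 r θ)) θ) :
    angularIntegral B r = 0 := by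
  rw [angularIntegral, intervalIntegral.integral_eq_sub_of_hasDerivAt (fun θ _ => hAB θ)
    ((continuous_comp_circleMap hB hr).intervalIntegrable _ _)]
  have : circleMap 0 r Real.pi = circleMap 0 r (-Real.pi) := by
    simp [circleMap_zero, Complex.exp_neg]
  rw [this, sub_self]

/-- Cauchy-Schwarz on a circle. -/
theorem norm_sq_angularIntegral_le {A : ℂ → ℂ} (hA : ContinuousOn A (Metric.ball 0 1)) {r : ℝ}
    (hr : r ∈ Set.Ioo (-1 : ℝ) 1) :
    ‖angularIntegral A r‖ ^ 2 ≤
      2 * Real.pi * ∫ θ in -Real.pi..Real.pi, ‖A (circleMap 0 r θ)‖ ^ 2 := by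
  have hc := (continuous_comp_circleMap hA hr).norm
  have hpi := Real.pi_pos
  set g := fun θ => ‖A (circleMap 0 r θ)‖ with hg
  have h1 : ‖angularIntegral A r‖ ≤ ∫ θ in -Real.pi..Real.pi, g θ :=
    intervalIntegral.norm_integral_le_integral_norm (by linarith)
  set J := ∫ θ in -Real.pi..Real.pi, g θ with hJ
  -- The variance of `g` is nonnegative.
  have h2 : 0 ≤ ∫ θ in -Real.pi..Real.pi, (g θ - J / (2 * Real.pi)) ^ 2 :=
    intervalIntegral.integral_nonneg (by linarith) fun θ _ => sq_nonneg _
  have h3 : ∫ θ in -Real.pi..Real.pi, (g θ - J / (2 * Real.pi)) ^ 2 =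
      (∫ θ in -Real.pi..Real.pi, g θ ^ 2) - J ^ 2 / (2 * Real.pi) := by
    have e : ∀ θ, (g θ - J / (2 * Real.pi)) ^ 2 =
        g θ ^ 2 - J / Real.pi * g θ + (J / (2 * Real.pi)) ^ 2 := fun θ => by
      field_simp
      ring
    simp only [e]
    rw [intervalIntegral.integral_add, intervalIntegral.integral_sub,
      intervalIntegral.integral_const_mul, intervalIntegral.integral_const, ← hJ, smul_eq_mul]
    · field_simp
      ring
    all_goals exact Continuous.intervalIntegrable (by fun_prop) _ _
  rw [h3, sub_nonneg, div_le_iff₀ (by positivity)] at h2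
  calc ‖angularIntegral A r‖ ^ 2 ≤ J ^ 2 := pow_le_pow_left₀ (norm_nonneg _) h1 2
    _ ≤ _ := by linarith

theorem norm_discFactor {w : ℂ} (hw : ‖w‖ < 1) : ‖discFactor k w‖ = 1 := by
  have h1 := norm_pos_iff.mpr (one_sub_ne_zero_of_norm_lt_one hw)
  have h3 : 1 - conj w = conj (1 - w) := by simp
  rw [discFactor, norm_zpow, norm_div, h3, RCLike.norm_conj, div_self h1.ne', one_zpow]

theorem discMap_zero : discMap z 0 = z := by
  apply Complex.ext <;> simp [discMap]

/-- The mean-value estimate in polar coordinates: the angular integral of `discPull z k F` solves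
the radial equation, since the terms with angular derivatives integrate to zero. -/
theorem exists_norm_sq_le_polar (k : ℤ) : ∃ C : ℝ, 0 < C ∧ ∀ (z : ℍ) (l : ℂ) (F : ℂ → ℂ),
    ContDiffOn ℝ 2 F {w : ℂ | 0 < w.im} →
    (∀ p : ℂ, 0 < p.im → (p.im : ℂ) ^ 2 * (fderiv ℝ (fderiv ℝ F) p 1 1 +
      fderiv ℝ (fderiv ℝ F) p Complex.I Complex.I) - 2 * Complex.I * k * p.im * fderiv ℝ F p 1 +
      l * F p = 0) →
    ‖F z‖ ^ 2 ≤ C * √(max l.re 1) * ∫ r in (0 : ℝ)..(1 / 2), r *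
      ∫ θ in -Real.pi..Real.pi, ‖F (discMap z (circleMap 0 r θ))‖ ^ 2 := by
  obtain ⟨C, hC, key⟩ := exists_norm_sq_le_integral k
  refine ⟨C, hC, fun z l F hF heq => ?_⟩
  have hpi := Real.pi_gt_three
  have hsub : Set.Icc (0 : ℝ) (1 / 2) ⊆ Set.Ioo (-1 : ℝ) 1 := fun x hx =>
    ⟨by linarith [hx.1], by linarith [hx.2]⟩
  have hsub' : Set.Ioo (0 : ℝ) (1 / 2) ⊆ Set.Ioo (0 : ℝ) 1 := Set.Ioo_subset_Ioo_right (by norm_num)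
  have hsub1 : Set.Ioo (0 : ℝ) 1 ⊆ Set.Ioo (-1 : ℝ) 1 := Set.Ioo_subset_Ioo_left (by norm_num)
  have c0 := continuousOn_discPull (z := z) (k := k) hF
  have c1 := continuousOn_discRad (z := z) (k := k) hF
  have c2 := continuousOn_discRad₂ (z := z) (k := k) hF
  have c3 := continuousOn_discAng (z := z) (k := k) hF
  have c4 := continuousOn_discAng₂ (z := z) (k := k) hF
  have h := key l (angularIntegral (discPull z k F)) (angularIntegral (discRad z k F))
    ((continuousOn_angularIntegral c0).mono hsub)
    ((continuousOn_angularIntegral c1).mono hsub) ?_ ?_ ?_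
  · have h0 : angularIntegral (discPull z k F) 0 = 2 * Real.pi * F z := by
      simp only [angularIntegral, circleMap_zero_radius, Function.const_apply,
        intervalIntegral.integral_const, discPull, discFactor, discMap_zero, map_zero, sub_zero,
        div_one, one_zpow, one_mul, Complex.real_smul]
      push_cast
      ring
    have hle : (∫ r in (0 : ℝ)..(1 / 2), r * ‖angularIntegral (discPull z k F) r‖ ^ 2) ≤
        ∫ r in (0 : ℝ)..(1 / 2), 2 * Real.pi * (r *
          ∫ θ in -Real.pi..Real.pi, ‖F (discMap z (circleMap 0 r θ))‖ ^ 2) := by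
      have hFc : ContinuousOn (fun w => ((‖F (discMap z w)‖ ^ 2 : ℝ) : ℂ)) (Metric.ball 0 1) := by
        have := (hF.continuousOn.comp continuousOn_discMap (mapsTo_discMap (z := z))).norm.pow 2
        exact Complex.continuous_ofReal.comp_continuousOn this
      have hcont : ContinuousOn (fun r => ∫ θ in -Real.pi..Real.pi,
          ‖F (discMap z (circleMap 0 r θ))‖ ^ 2) (Set.Icc 0 (1 / 2)) := by
        have := Complex.continuous_re.comp_continuousOn
          ((continuousOn_angularIntegral hFc).mono hsub)
        refine this.congr fun r _ => ?_
        simp only [Function.comp, angularIntegral]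
        rw [intervalIntegral.integral_ofReal, Complex.ofReal_re]
      have hM := (continuousOn_angularIntegral c0).mono hsub
      refine intervalIntegral.integral_mono_on (by norm_num) ?_ ?_ fun r hr => ?_
      · refine ContinuousOn.intervalIntegrable ?_
        rw [Set.uIcc_of_le (by norm_num)]
        exact continuousOn_id.mul (hM.norm.pow 2)
      · refine ContinuousOn.intervalIntegrable ?_
        rw [Set.uIcc_of_le (by norm_num)]
        exact continuousOn_const.mul (continuousOn_id.mul hcont)
      · have h1 := norm_sq_angularIntegral_le c0 (hsub hr)
        have h2 : ∀ θ, ‖discPull z k F (circleMap 0 r θ)‖ = ‖F (discMap z (circleMap 0 r θ))‖ :=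
          fun θ => by
            rw [discPull, norm_mul, norm_discFactor (norm_circleMap_lt_one θ (hsub hr)), one_mul]
        simp only [h2] at h1
        have := mul_le_mul_of_nonneg_left h1 hr.1
        linarith
    rw [intervalIntegral.integral_const_mul] at hle
    set J := ∫ r in (0 : ℝ)..(1 / 2), r *
      ∫ θ in -Real.pi..Real.pi, ‖F (discMap z (circleMap 0 r θ))‖ ^ 2
    have h1 : (2 * Real.pi) ^ 2 * ‖F z‖ ^ 2 ≤ C * √(max l.re 1) * (2 * Real.pi * J) := by
      have e : ‖angularIntegral (discPull z k F) 0‖ ^ 2 = (2 * Real.pi) ^ 2 * ‖F z‖ ^ 2 := by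
        rw [h0, norm_mul, mul_pow]
        congr 2
        rw [norm_mul, Complex.norm_real, Real.norm_of_nonneg (by linarith)]
        simp
      rw [← e]
      exact h.trans (mul_le_mul_of_nonneg_left hle (by positivity))
    have hF2 : 0 ≤ ‖F z‖ ^ 2 := by positivity
    have h2 : 2 * Real.pi * (2 * Real.pi * ‖F z‖ ^ 2) ≤
        2 * Real.pi * (C * √(max l.re 1) * J) := by linarith
    have h3 := le_of_mul_le_mul_left h2 (by positivity)
    nlinarith
  · simp [angularIntegral, discRad, discField]
  · intro r hr
    exact hasDerivAt_angularIntegral c0 c1 (fun θ x hx => hasDerivAt_discPull_of_real hF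
      (c := fun x => circleMap 0 x θ) (norm_circleMap_lt_one θ (hsub1 hx))
      (hasDerivAt_polar_radius x θ hx.1.ne')) (hsub' hr)
  · intro r hr
    have hd := hasDerivAt_angularIntegral c1 c2 (fun θ x hx => hasDerivAt_discRad_of_real hF
      (c := fun x => circleMap 0 x θ) (norm_circleMap_lt_one θ (hsub1 hx))
      (hasDerivAt_polar_radius x θ hx.1.ne')) (hsub' hr)
    convert! hd using 1
    have hr1 := hsub1 (hsub' hr)
    have hr0 : (r : ℂ) ≠ 0 := by exact_mod_cast hr.1.ne'
    have z1 : angularIntegral (discAng z k F) r = 0 := angularIntegral_eq_zero c3 hr1 fun θ =>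
      hasDerivAt_discPull_angle hF θ hr1
    have z2 : angularIntegral (discAng₂ z k F) r = 0 := angularIntegral_eq_zero c4 hr1 fun θ =>
      hasDerivAt_discAng_angle hF θ hr1
    have hsum : ∀ θ, discRad₂ z k F (circleMap 0 r θ) =
        4 * Complex.I * k * r ^ 2 / (1 - r ^ 2) * discAng z k F (circleMap 0 r θ) -
        discAng₂ z k F (circleMap 0 r θ) -
        r ^ 2 * radialPotential k l r * discPull z k F (circleMap 0 r θ) := by
      intro θ
      have e1 := discRad₂_add_discAng₂ (z := z) hF heq (norm_circleMap_lt_one θ hr1)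
      have e2 : circleMap 0 r θ * conj (circleMap 0 r θ) = r ^ 2 := by
        rw [Complex.mul_conj, Complex.normSq_eq_norm_sq, norm_circleMap_zero, sq_abs]
        push_cast
        rfl
      rw [e2] at e1
      rw [radialPotential]
      linear_combination e1
    have hI : angularIntegral (discRad₂ z k F) r =
        4 * Complex.I * k * r ^ 2 / (1 - r ^ 2) * angularIntegral (discAng z k F) r -
        angularIntegral (discAng₂ z k F) r -
        r ^ 2 * radialPotential k l r * angularIntegral (discPull z k F) r := by
      have i0 := (continuous_comp_circleMap c0 hr1).intervalIntegrable (μ := volume)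
        (-Real.pi) Real.pi
      have i3 := (continuous_comp_circleMap c3 hr1).intervalIntegrable (μ := volume)
        (-Real.pi) Real.pi
      have i4 := (continuous_comp_circleMap c4 hr1).intervalIntegrable (μ := volume)
        (-Real.pi) Real.pi
      simp only [angularIntegral, hsum]
      rw [intervalIntegral.integral_sub ((i3.const_mul _).sub i4) (i0.const_mul _),
        intervalIntegral.integral_sub (i3.const_mul _) i4, intervalIntegral.integral_const_mul,
        intervalIntegral.integral_const_mul]
    rw [hI, z1, z2]
    field_simp
    ring

theorem partialX_eq (hF : ContDiffOn ℝ 2 F {w : ℂ | 0 < w.im}) {p : ℂ} (hp : 0 < p.im) :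
    partialX F p = fderiv ℝ F p 1 :=
  (hasFDerivAt_of_im_pos hF hp).differentiableAt.lineDeriv_eq_fderiv

theorem partialY_eq (hF : ContDiffOn ℝ 2 F {w : ℂ | 0 < w.im}) {p : ℂ} (hp : 0 < p.im) :
    partialY F p = fderiv ℝ F p Complex.I :=
  (hasFDerivAt_of_im_pos hF hp).differentiableAt.lineDeriv_eq_fderiv

theorem partialX_partialX_eq (hF : ContDiffOn ℝ 2 F {w : ℂ | 0 < w.im}) {p : ℂ} (hp : 0 < p.im) :
    partialX (partialX F) p = fderiv ℝ (fderiv ℝ F) p 1 1 := by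
  have h : partialX F =ᶠ[nhds p] fun q => fderiv ℝ F q 1 := by
    filter_upwards [isOpen_im_pos.mem_nhds hp] with q hq
    exact partialX_eq hF hq
  rw [partialX, h.lineDeriv_eq]
  exact ((hasFDerivAt_fderiv_of_im_pos hF hp).clm_apply (hasFDerivAt_const 1 p)).hasLineDerivAt 1
    |>.lineDeriv.trans (by simp)

theorem partialY_partialY_eq (hF : ContDiffOn ℝ 2 F {w : ℂ | 0 < w.im}) {p : ℂ} (hp : 0 < p.im) :
    partialY (partialY F) p = fderiv ℝ (fderiv ℝ F) p Complex.I Complex.I := by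
  have h : partialY F =ᶠ[nhds p] fun q => fderiv ℝ F q Complex.I := by
    filter_upwards [isOpen_im_pos.mem_nhds hp] with q hq
    exact partialY_eq hF hq
  rw [partialY, h.lineDeriv_eq]
  exact ((hasFDerivAt_fderiv_of_im_pos hF hp).clm_apply
    (hasFDerivAt_const Complex.I p)).hasLineDerivAt Complex.I |>.lineDeriv.trans (by simp)

end mean

/-! ### The local estimate on the half-plane -/

section change

variable {z : ℍ} {k : ℤ} {F : ℂ → ℂ} {l : ℂ}

theorem integral_polar_eq_integral_ball {h : ℂ → ℝ} (hh : ContinuousOn h (Metric.ball 0 1)) :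
    (∫ r in (0 : ℝ)..(1 / 2), r * ∫ θ in -Real.pi..Real.pi, h (circleMap 0 r θ)) =
      ∫ w in Metric.ball (0 : ℂ) (1 / 2), h w := by
  have hpi := Real.pi_pos
  rw [← integral_indicator Metric.isOpen_ball.measurableSet,
    ← Complex.integral_comp_polarCoord_symm]
  have hS : MeasurableSet (Set.Ioo (0 : ℝ) (1 / 2) ×ˢ Set.Ioo (-Real.pi) Real.pi) :=
    measurableSet_Ioo.prod measurableSet_Ioo
  have hcirc : ∀ p : ℝ × ℝ, Complex.polarCoord.symm p = circleMap 0 p.1 p.2 := fun p => by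
    rw [Complex.polarCoord_symm_apply, circleMap_zero, Complex.exp_mul_I]
    push_cast
    rfl
  have e1 : ∀ p ∈ polarCoord.target, p.1 • (Metric.ball (0 : ℂ) (1 / 2)).indicator h
      (Complex.polarCoord.symm p) =
      (Set.Ioo (0 : ℝ) (1 / 2) ×ˢ Set.Ioo (-Real.pi) Real.pi).indicator
        (fun p : ℝ × ℝ => p.1 * h (circleMap 0 p.1 p.2)) p := by
    rintro ⟨r, θ⟩ hp
    have hp1 : 0 < r := hp.1
    have hp2 : θ ∈ Set.Ioo (-Real.pi) Real.pi := hp.2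
    rw [hcirc]
    by_cases hr : r < 1 / 2
    · rw [Set.indicator_of_mem, Set.indicator_of_mem, smul_eq_mul]
      · exact ⟨⟨hp1, hr⟩, hp2⟩
      · rw [mem_ball_zero_iff, norm_circleMap_zero, abs_of_pos hp1]
        exact hr
    · rw [Set.indicator_of_notMem, Set.indicator_of_notMem, smul_zero]
      · exact fun hmem => hr hmem.1.2
      · rw [mem_ball_zero_iff, norm_circleMap_zero, abs_of_pos hp1]
        exact hr
  rw [setIntegral_congr_fun polarCoord.open_target.measurableSet e1, setIntegral_indicator hS]
  have e2 : polarCoord.target ∩ Set.Ioo (0 : ℝ) (1 / 2) ×ˢ Set.Ioo (-Real.pi) Real.pi =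
      Set.Ioo (0 : ℝ) (1 / 2) ×ˢ Set.Ioo (-Real.pi) Real.pi := by
    rw [Set.inter_eq_right]
    rintro ⟨r, θ⟩ hp
    exact ⟨hp.1.1, hp.2⟩
  rw [e2, Measure.volume_eq_prod, setIntegral_prod]
  · rw [intervalIntegral.integral_of_le (by norm_num), integral_Ioc_eq_integral_Ioo]
    refine setIntegral_congr_fun measurableSet_Ioo fun r _ => ?_
    simp only
    rw [integral_const_mul, intervalIntegral.integral_of_le (by linarith),
      integral_Ioc_eq_integral_Ioo]
  · have hc : ContinuousOn (fun p : ℝ × ℝ => p.1 * h (circleMap 0 p.1 p.2))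
        (Set.Icc (0 : ℝ) (1 / 2) ×ˢ Set.Icc (-Real.pi) Real.pi) := by
      refine continuousOn_fst.mul (hh.comp continuous_circleMap_uncurry.continuousOn ?_)
      rintro ⟨r, θ⟩ hp
      rw [mem_ball_zero_iff, norm_circleMap_zero, abs_of_nonneg hp.1.1]
      linarith [hp.1.2]
    rw [← Measure.volume_eq_prod]
    exact (hc.integrableOn_compact (isCompact_Icc.prod isCompact_Icc)).mono_set
      (Set.prod_mono Set.Ioo_subset_Icc_self Set.Ioo_subset_Icc_self)

/-- The disc of radius `1 / 2` about `z` in the coordinate `discMap z`. -/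
def discNbhd (z : ℍ) : Set ℍ := UpperHalfPlane.coe ⁻¹' (discMap z '' Metric.ball 0 (1 / 2))

theorem lintegral_eq_lintegral_coe {s : Set ℂ} (hs : MeasurableSet s) (hs' : s ⊆ {w : ℂ | 0 < w.im})
    (g : ℍ → ENNReal) :
    ∫⁻ ζ in UpperHalfPlane.coe ⁻¹' s, g ζ =
      ∫⁻ p in s, ENNReal.ofReal (1 / p.im ^ 2) * g (ofComplex p) := by
  have hmp : MeasurePreserving UpperHalfPlane.coe (volume.comap UpperHalfPlane.coe)
      (volume.restrict (.range UpperHalfPlane.coe)) :=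
    ⟨measurable_coe, by rw [measurableEmbedding_coe.map_comap]⟩
  have hd : Measurable fun ζ : ℍ => (((1 / NNReal.mk ζ.im ζ.im_pos.le : NNReal) ^ 2 : NNReal) :
      ENNReal) := by
    refine measurable_coe_nnreal_ennreal.comp (Continuous.measurable ?_)
    refine .pow (.div₀ continuous_const ?_ ?_) _
    · exact continuous_im.subtype_mk _
    · exact fun x ↦ NNReal.ne_iff.mp x.im_ne_zero
  rw [volume_def, setLIntegral_withDensity_eq_setLIntegral_mul_non_measurable _ hd _
    (measurable_coe hs) (Filter.Eventually.of_forall fun _ => ENNReal.coe_lt_top)]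
  have e1 : ∀ ζ : ℍ, ((fun ζ : ℍ => (((1 / NNReal.mk ζ.im ζ.im_pos.le : NNReal) ^ 2 : NNReal) :
      ENNReal)) * g) ζ = (fun p : ℂ => ENNReal.ofReal (1 / p.im ^ 2) * g (ofComplex p)) ζ := by
    intro ζ
    simp only [Pi.mul_apply, ofComplex_apply]
    congr 1
    rw [ENNReal.ofReal, ENNReal.coe_inj]
    ext
    rw [Real.coe_toNNReal _ (by positivity)]
    simp
  simp only [e1]
  refine (hmp.setLIntegral_comp_preimage_emb measurableEmbedding_coe
    (fun p : ℂ => ENNReal.ofReal (1 / p.im ^ 2) * g (ofComplex p)) s).trans ?_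
  rw [Measure.restrict_restrict hs]
  congr 2
  rw [Set.inter_eq_left]
  intro p hp
  exact ⟨⟨p, hs' hp⟩, rfl⟩

theorem injOn_discMap : Set.InjOn (discMap z) (Metric.ball 0 (1 / 2)) := by
  intro w hw v hv h
  have hw1 := one_sub_ne_zero_of_norm_lt_one (w := w)
    (lt_trans (mem_ball_zero_iff.mp hw) (by norm_num))
  have hv1 := one_sub_ne_zero_of_norm_lt_one (w := v)
    (lt_trans (mem_ball_zero_iff.mp hv) (by norm_num))
  have hy : (z.im : ℂ) ≠ 0 := by exact_mod_cast z.im_ne_zero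
  simp only [discMap, add_right_inj, mul_eq_mul_left_iff, hy, or_false] at h
  rw [div_eq_div_iff hw1 hv1, mul_assoc, mul_assoc] at h
  have := mul_left_cancel₀ Complex.I_ne_zero h
  linear_combination this / 2

/-- The pull-back of `dx dy / y²` under `discMap z` is `4 / (1 - |w|²)²` times the Lebesgue
measure of the disc, hence dominates it. -/
theorem lintegral_ball_le_lintegral_discNbhd (z : ℍ) (g : ℍ → ENNReal) :
    ∫⁻ w in Metric.ball (0 : ℂ) (1 / 2), g (ofComplex (discMap z w)) ≤ ∫⁻ ζ in discNbhd z, g ζ := by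
  have hB : MeasurableSet (Metric.ball (0 : ℂ) (1 / 2)) := Metric.isOpen_ball.measurableSet
  have hlt : ∀ w ∈ Metric.ball (0 : ℂ) (1 / 2), ‖w‖ < 1 := fun w hw =>
    lt_trans (mem_ball_zero_iff.mp hw) (by norm_num)
  have hder : ∀ w ∈ Metric.ball (0 : ℂ) (1 / 2), HasFDerivWithinAt (discMap z)
      ((ContinuousLinearMap.toSpanSingleton ℂ
        (2 * Complex.I * z.im / (1 - w) ^ 2)).restrictScalars ℝ) (Metric.ball (0 : ℂ) (1 / 2)) w :=
    fun w hw => ((hasDerivAt_discMap (hlt w hw)).hasFDerivAt.restrictScalars ℝ).hasFDerivWithinAt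
  have himg : MeasurableSet (discMap z '' Metric.ball 0 (1 / 2)) :=
    measurable_image_of_fderivWithin hB hder injOn_discMap
  rw [discNbhd, lintegral_eq_lintegral_coe himg (by
      rintro _ ⟨w, hw, rfl⟩
      exact im_discMap_pos (hlt w hw)),
    lintegral_image_eq_lintegral_abs_det_fderiv_mul volume hB hder injOn_discMap]
  refine setLIntegral_mono' hB fun w hw => ?_
  have hw1 := hlt w hw
  have hdet : ((ContinuousLinearMap.toSpanSingleton ℂ
      (2 * Complex.I * z.im / (1 - w) ^ 2)).restrictScalars ℝ).det =
      (2 * z.im) ^ 2 / ‖1 - w‖ ^ 4 := by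
    have : ((ContinuousLinearMap.toSpanSingleton ℂ
      (2 * Complex.I * z.im / (1 - w) ^ 2)).restrictScalars ℝ).det =
      ‖2 * Complex.I * z.im / (1 - w) ^ 2‖ ^ 2 := by
      simp [ContinuousLinearMap.det, LinearMap.det_restrictScalars, Algebra.norm_complex_eq,
        Complex.normSq_eq_norm_sq, div_pow]
    rw [this, norm_div, norm_pow, div_pow, ← pow_mul, norm_mul, norm_mul, Complex.norm_I,
      Complex.norm_real, Real.norm_of_nonneg z.im_pos.le]
    simp
  rw [hdet, ← mul_assoc, ← ENNReal.ofReal_mul (abs_nonneg _)]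
  refine le_mul_of_one_le_left' ?_
  rw [← ENNReal.ofReal_one]
  refine ENNReal.ofReal_le_ofReal ?_
  have h1 : 0 < ‖1 - w‖ := norm_pos_iff.mpr (one_sub_ne_zero_of_norm_lt_one hw1)
  have h2 : 0 < 1 - ‖w‖ ^ 2 := by nlinarith [norm_nonneg w]
  have h3 := z.im_pos
  rw [im_discMap hw1, abs_of_nonneg (by positivity)]
  have e : (2 * z.im) ^ 2 / ‖1 - w‖ ^ 4 * (1 / (z.im * (1 - ‖w‖ ^ 2) / ‖1 - w‖ ^ 2) ^ 2) =
      4 / (1 - ‖w‖ ^ 2) ^ 2 := by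
    field_simp
    norm_num
  rw [e, le_div_iff₀ (by positivity)]
  nlinarith [sq_nonneg ‖w‖]

/-- The local estimate: its constant depends on the weight only. -/
theorem exists_ofReal_norm_sq_le_lintegral (k : ℤ) : ∃ C : ℝ, 0 < C ∧ ∀ (z : ℍ) (l : ℂ) (f : ℍ → ℂ),
    ContDiffOn ℝ 2 (f ∘ ofComplex) {w : ℂ | 0 < w.im} →
    (∀ p : ℍ, weightLaplacian k f p + l * f p = 0) →
    ENNReal.ofReal (‖f z‖ ^ 2) ≤ ENNReal.ofReal (C * √(max l.re 1)) *
      ∫⁻ ζ in discNbhd z, ENNReal.ofReal (‖f ζ‖ ^ 2) := by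
  obtain ⟨C, hC, key⟩ := exists_norm_sq_le_polar k
  refine ⟨C, hC, fun z l f hF heq => ?_⟩
  have h := key z l (f ∘ ofComplex) hF fun p hp => by
    have h1 := heq ⟨p, hp⟩
    rw [weightLaplacian] at h1
    simp only at h1
    rw [partialX_partialX_eq hF hp, partialY_partialY_eq hF hp, partialX_eq hF hp] at h1
    rw [Function.comp, ofComplex_apply_of_im_pos hp]
    exact h1
  have hc : ContinuousOn (fun w => ‖(f ∘ ofComplex) (discMap z w)‖ ^ 2) (Metric.ball 0 1) :=
    (hF.continuousOn.comp continuousOn_discMap (mapsTo_discMap (z := z))).norm.pow 2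
  rw [integral_polar_eq_integral_ball hc] at h
  have hint : IntegrableOn (fun w => ‖(f ∘ ofComplex) (discMap z w)‖ ^ 2)
      (Metric.ball (0 : ℂ) (1 / 2)) :=
    ((hc.mono (Metric.closedBall_subset_ball (by norm_num))).integrableOn_compact
      (isCompact_closedBall (0 : ℂ) (1 / 2))).mono_set Metric.ball_subset_closedBall
  calc ENNReal.ofReal (‖f z‖ ^ 2)
      ≤ ENNReal.ofReal (C * √(max l.re 1) * ∫ w in Metric.ball (0 : ℂ) (1 / 2),
          ‖(f ∘ ofComplex) (discMap z w)‖ ^ 2) := by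
        refine ENNReal.ofReal_le_ofReal ?_
        simpa using h
    _ = ENNReal.ofReal (C * √(max l.re 1)) * ∫⁻ w in Metric.ball (0 : ℂ) (1 / 2),
          ENNReal.ofReal (‖f (ofComplex (discMap z w))‖ ^ 2) := by
        rw [ENNReal.ofReal_mul (by positivity), ofReal_integral_eq_lintegral_ofReal hint
          (Filter.Eventually.of_forall fun _ => by positivity)]
        rfl
    _ ≤ _ := mul_le_mul_right (lintegral_ball_le_lintegral_discNbhd z fun ζ =>
          ENNReal.ofReal (‖f ζ‖ ^ 2)) _

end change

/-! ### The measure on the quotient -/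

section quotient

variable {Γ : Subgroup SL(2, ℝ)}

theorem proj_eq_iff {z w : ℍ} : proj Γ z = proj Γ w ↔ ∃ γ : Γ, γ • w = z := by
  rw [proj, proj, Quotient.eq, MulAction.orbitRel_apply, MulAction.mem_orbit_iff]

theorem proj_smul (γ : Γ) (z : ℍ) : proj Γ (γ • z) = proj Γ z := proj_eq_iff.mpr ⟨γ, rfl⟩

theorem continuous_proj : Continuous (proj Γ) := continuous_quot_mk

theorem isOpenMap_proj : IsOpenMap (proj Γ) := isOpenMap_quotient_mk'_mul

theorem measurable_proj : Measurable (proj Γ) := measurable_quot_mk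

theorem continuous_smul_subgroup (γ : Γ) : Continuous fun z : ℍ => γ • z := continuous_const_smul γ

theorem measurePreserving_smul_subgroup (γ : Γ) :
    MeasurePreserving (fun z : ℍ => γ • z) volume volume :=
  measurePreserving_smul ((γ : SL(2, ℝ)) : GL (Fin 2) ℝ) (volume : Measure ℍ)

theorem measurableEmbedding_smul_subgroup (γ : Γ) : MeasurableEmbedding fun z : ℍ => γ • z :=
  (Homeomorph.smul γ).measurableEmbedding

theorem measurableSet_of_isCompact_quotient [DiscreteTopology Γ] {s : Set (HQuot Γ)}
    (hs : IsCompact s) : MeasurableSet s :=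
  measurableSet_quotient.mpr (hs.isClosed.preimage continuous_proj).measurableSet

theorem exists_isCompact_subset_image_proj {C : Set (HQuot Γ)} (hC : IsCompact C) :
    ∃ K : Set ℍ, IsCompact K ∧ C ⊆ proj Γ '' K := by
  choose N hN hN' using fun z : ℍ => exists_compact_mem_nhds z
  obtain ⟨t, ht⟩ := hC.elim_finite_subcover (fun z : ℍ => proj Γ '' interior (N z))
    (fun z => isOpenMap_proj _ isOpen_interior) (by
      intro q _
      induction q using Quotient.inductionOn with
      | h z => exact Set.mem_iUnion.mpr ⟨z, z, mem_interior_iff_mem_nhds.mpr (hN' z), rfl⟩)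
  refine ⟨⋃ z ∈ t, N z, t.isCompact_biUnion fun z _ => hN z, fun q hq => ?_⟩
  obtain ⟨z, hz, w, hw, rfl⟩ := Set.mem_iUnion₂.mp (ht hq)
  exact ⟨w, Set.mem_iUnion₂.mpr ⟨z, hz, interior_subset hw⟩, rfl⟩

theorem exists_injective_measurable_real : ∃ e : ℍ → ℝ, Function.Injective e ∧ Measurable e :=
  ⟨embeddingReal ℂ ∘ UpperHalfPlane.coe,
    (measurableEmbedding_embeddingReal ℂ).injective.comp measurableEmbedding_coe.injective,
    (measurableEmbedding_embeddingReal ℂ).measurable.comp measurable_coe⟩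

/-- Only finitely many translates of a compact set `K` meet `K`; choosing the least point of every
orbit in `K` for some measurable linear order gives a set `U` of representatives, and `K` is
covered by finitely many translates of `U`. -/
theorem exists_lintegral_le_nat_mul [DiscreteTopology Γ] {K : Set ℍ} (hK : IsCompact K) :
    ∃ n : ℕ, ∀ g : HQuot Γ → ENNReal, Measurable g →
      ∫⁻ ζ in K, g (proj Γ ζ) ≤ n * ∫⁻ q in proj Γ '' K, g q ∂(quotMeasure Γ) := by
  classical
  obtain ⟨e, he, hem⟩ := exists_injective_measurable_real
  have hfin : {γ : Γ | (((fun z : ℍ => γ • z) '' K) ∩ K).Nonempty}.Finite :=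
    ProperlyDiscontinuousSMul.finite_disjoint_inter_image hK hK
  set S := hfin.toFinset with hS
  have hmemS : ∀ (γ : Γ) (w : ℍ), w ∈ K → γ • w ∈ K → γ ∈ S := fun γ w h1 h2 => by
    rw [hS, Set.Finite.mem_toFinset]
    exact ⟨γ • w, ⟨w, h1, rfl⟩, h2⟩
  have hKm : MeasurableSet K := hK.isClosed.measurableSet
  have hC' : MeasurableSet (proj Γ '' K) :=
    measurableSet_of_isCompact_quotient (hK.image continuous_proj)
  set U : Set ℍ := K ∩ ⋂ γ ∈ S, {w | γ • w ∈ K → e w ≤ e (γ • w)} with hU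
  have hUm : MeasurableSet U := by
    refine hKm.inter (Finset.measurableSet_biInter _ fun γ _ => ?_)
    have hγ := (continuous_smul_subgroup γ).measurable
    have : {w : ℍ | γ • w ∈ K → e w ≤ e (γ • w)} =
        ((fun w : ℍ => γ • w) ⁻¹' K)ᶜ ∪ {w | e w ≤ e (γ • w)} := by
      ext w
      simp [imp_iff_not_or]
    rw [this]
    exact (hγ hKm).compl.union (measurableSet_le hem (hem.comp hγ))
  have hUle : ∀ (γ : Γ) (w : ℍ), w ∈ U → γ • w ∈ K → e w ≤ e (γ • w) := fun γ w hw h2 =>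
    Set.mem_iInter₂.mp hw.2 γ (hmemS γ w hw.1 h2) h2
  have hUinj : Set.InjOn (proj Γ) U := by
    intro v hv w hw h
    obtain ⟨γ, hγ⟩ := proj_eq_iff.mp h
    refine he (le_antisymm ?_ ?_)
    · have h2 : γ⁻¹ • v = w := by rw [← hγ, inv_smul_smul]
      have := hUle γ⁻¹ v hv (by rw [h2]; exact hw.1)
      rwa [h2] at this
    · have := hUle γ w hw (by rw [hγ]; exact hv.1)
      rwa [hγ] at this
  have hcov : K ⊆ ⋃ γ ∈ S, (fun w : ℍ => γ • w) ⁻¹' U := by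
    intro w hw
    obtain ⟨γ, hγ, hmin⟩ := Finset.exists_min_image (S.filter fun γ => γ • w ∈ K)
      (fun γ => e (γ • w)) ⟨1, by
        rw [Finset.mem_filter, one_smul]
        exact ⟨hmemS 1 w hw (by rwa [one_smul]), hw⟩⟩
    rw [Finset.mem_filter] at hγ
    refine Set.mem_iUnion₂.mpr ⟨γ, hγ.1, hγ.2, Set.mem_iInter₂.mpr fun δ _ hδ => ?_⟩
    change e (γ • w) ≤ e (δ • γ • w)
    change δ • γ • w ∈ K at hδ
    rw [← mul_smul] at hδ ⊢
    exact hmin _ (Finset.mem_filter.mpr ⟨hmemS _ w hw hδ, hδ⟩)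
  refine ⟨S.card, fun g hg => ?_⟩
  have hν : ((volume : Measure ℍ).restrict U).map (proj Γ) ≤ quotMeasure Γ :=
    le_sSup ⟨U, hUm, hUinj, rfl⟩
  have hUint : ∫⁻ ζ in U, g (proj Γ ζ) ≤ ∫⁻ q in proj Γ '' K, g q ∂(quotMeasure Γ) := by
    calc ∫⁻ ζ in U, g (proj Γ ζ) = ∫⁻ ζ in U, (proj Γ '' K).indicator g (proj Γ ζ) := by
          refine setLIntegral_congr_fun hUm fun ζ hζ => ?_
          rw [Set.indicator_of_mem (Set.mem_image_of_mem _ hζ.1)]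
      _ = ∫⁻ q, (proj Γ '' K).indicator g q ∂(((volume : Measure ℍ).restrict U).map (proj Γ)) :=
          (lintegral_map (hg.indicator hC') measurable_proj).symm
      _ ≤ ∫⁻ q, (proj Γ '' K).indicator g q ∂(quotMeasure Γ) := lintegral_mono' hν le_rfl
      _ = _ := lintegral_indicator hC' g
  calc ∫⁻ ζ in K, g (proj Γ ζ)
      ≤ ∫⁻ ζ in ⋃ γ ∈ S, (fun w : ℍ => γ • w) ⁻¹' U, g (proj Γ ζ) := lintegral_mono_set hcov
    _ ≤ ∑ γ ∈ S, ∫⁻ ζ in (fun w : ℍ => γ • w) ⁻¹' U, g (proj Γ ζ) := by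
        rw [← lintegral_finsetSum_measure, ← Measure.sum_coe_finset]
        exact lintegral_mono' (Measure.restrict_biUnion_le S.countable_toSet) le_rfl
    _ = ∑ γ ∈ S, ∫⁻ ζ in U, g (proj Γ ζ) := by
        refine Finset.sum_congr rfl fun γ _ => ?_
        have h := (measurePreserving_smul_subgroup γ).setLIntegral_comp_preimage_emb
          (measurableEmbedding_smul_subgroup γ) (fun ζ => g (proj Γ ζ)) U
        simpa only [proj_smul] using h
    _ ≤ S.card * ∫⁻ q in proj Γ '' K, g q ∂(quotMeasure Γ) := by
        rw [Finset.sum_const, nsmul_eq_mul]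
        gcongr

/-- A set of pairwise inequivalent points that have translates in `K` can be moved into `K`
piecewise, without overlaps. -/
theorem volume_inter_preimage_le [Countable Γ] {K U : Set ℍ} {E : Set (HQuot Γ)}
    (hK : MeasurableSet K) (hU : MeasurableSet U) (hUinj : Set.InjOn (proj Γ) U)
    (hE : MeasurableSet E) (hEK : E ⊆ proj Γ '' K) :
    volume (U ∩ proj Γ ⁻¹' E) ≤ volume (K ∩ proj Γ ⁻¹' E) := by
  obtain ⟨φ, hφ⟩ := exists_surjective_nat Γ
  set A : ℕ → Set ℍ := fun n => (U ∩ proj Γ ⁻¹' E) ∩ (fun w : ℍ => φ n • w) ⁻¹' K with hA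
  have hAm : ∀ n, MeasurableSet (A n) := fun n =>
    (hU.inter (measurable_proj hE)).inter ((continuous_smul_subgroup (φ n)).measurable hK)
  have hVm : ∀ n, MeasurableSet (disjointed A n) := fun n => .disjointed hAm n
  have hVA : ∀ n, disjointed A n ⊆ A n := fun n => disjointed_subset A n
  have hcov : U ∩ proj Γ ⁻¹' E ⊆ ⋃ n, disjointed A n := by
    rw [iUnion_disjointed]
    intro w hw
    obtain ⟨v, hv, hvw⟩ := hEK hw.2
    obtain ⟨γ, hγ⟩ := proj_eq_iff.mp hvw
    obtain ⟨n, rfl⟩ := hφ γ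
    exact Set.mem_iUnion.mpr ⟨n, hw, by simpa [hγ] using hv⟩
  have hinv : ∀ n, volume (disjointed A n) =
      volume ((fun w : ℍ => (φ n)⁻¹ • w) ⁻¹' disjointed A n) := fun n =>
    ((measurePreserving_smul_subgroup (φ n)⁻¹).measure_preimage (hVm n).nullMeasurableSet).symm
  calc volume (U ∩ proj Γ ⁻¹' E) ≤ volume (⋃ n, disjointed A n) := measure_mono hcov
    _ ≤ ∑' n, volume (disjointed A n) := measure_iUnion_le _
    _ = ∑' n, volume ((fun w : ℍ => (φ n)⁻¹ • w) ⁻¹' disjointed A n) := by simp only [hinv]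
    _ = volume (⋃ n, (fun w : ℍ => (φ n)⁻¹ • w) ⁻¹' disjointed A n) := by
        refine (measure_iUnion (fun m n hmn => ?_) fun n =>
          (continuous_smul_subgroup (φ n)⁻¹).measurable (hVm n)).symm
        rw [Function.onFun, Set.disjoint_left]
        intro x hm hn
        have hm' := hVA m hm
        have hn' := hVA n hn
        have : (φ m)⁻¹ • x = (φ n)⁻¹ • x :=
          hUinj hm'.1.1 hn'.1.1 (by rw [proj_smul, proj_smul])
        refine Set.disjoint_left.mp (disjoint_disjointed A hmn) hm ?_
        change (φ m)⁻¹ • x ∈ disjointed A n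
        rw [this]
        exact hn
    _ ≤ volume (K ∩ proj Γ ⁻¹' E) := by
        refine measure_mono (Set.iUnion_subset fun n x hx => ?_)
        have hx' := hVA n hx
        refine ⟨by simpa using hx'.2, ?_⟩
        have := hx'.1.2
        rwa [Set.mem_preimage, proj_smul] at this

theorem countable_of_discrete [DiscreteTopology Γ] : Countable Γ := by
  have : SecondCountableTopology (Matrix (Fin 2) (Fin 2) ℝ) :=
    inferInstanceAs (SecondCountableTopology (Fin 2 → Fin 2 → ℝ))
  have : SecondCountableTopology SL(2, ℝ) :=
    Matrix.SpecialLinearGroup.isClosedEmbedding_val.isEmbedding.secondCountableTopology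
  exact TopologicalSpace.separableSpace_iff_countable.mp inferInstance

/-- `quotMeasure` is finite on compact sets. The supremum that defines it is bounded by the image
of `μ|_K` on `proj K`, and by the largest measure off `proj K`. -/
theorem quotMeasure_image_lt_top [DiscreteTopology Γ] {K : Set ℍ} (hK : IsCompact K) :
    quotMeasure Γ (proj Γ '' K) < ⊤ := by
  have := countable_of_discrete (Γ := Γ)
  have hKm : MeasurableSet K := hK.isClosed.measurableSet
  have hC' : MeasurableSet (proj Γ '' K) :=
    measurableSet_of_isCompact_quotient (hK.image continuous_proj)
  have hle : quotMeasure Γ ≤ ((volume : Measure ℍ).restrict K).map (proj Γ) +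
      (⊤ : Measure (HQuot Γ)).restrict (proj Γ '' K)ᶜ := by
    refine sSup_le ?_
    rintro _ ⟨U, hU, hUinj, rfl⟩
    set ν := ((volume : Measure ℍ).restrict U).map (proj Γ) with hν
    rw [← Measure.restrict_add_restrict_compl (μ := ν) hC']
    refine add_le_add (Measure.le_iff.mpr fun E hE => ?_)
      (Measure.restrict_mono le_rfl le_top)
    have hm := hE.inter hC'
    rw [Measure.restrict_apply hE, hν, Measure.map_apply measurable_proj hm,
      Measure.map_apply measurable_proj hE, Measure.restrict_apply (measurable_proj hm),
      Measure.restrict_apply (measurable_proj hE), Set.inter_comm _ U, Set.inter_comm _ K]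
    exact (volume_inter_preimage_le hKm hU hUinj hm Set.inter_subset_right).trans
      (measure_mono (Set.inter_subset_inter_right _ (Set.preimage_mono Set.inter_subset_left)))
  refine (hle _).trans_lt ?_
  rw [Measure.add_apply, Measure.restrict_apply hC', Set.inter_compl_self, measure_empty, add_zero]
  calc ((volume : Measure ℍ).restrict K).map (proj Γ) (proj Γ '' K)
      ≤ ((volume : Measure ℍ).restrict K).map (proj Γ) Set.univ := measure_mono (Set.subset_univ _)
    _ = volume K := by
        rw [Measure.map_apply measurable_proj .univ, Set.preimage_univ, Measure.restrict_apply_univ]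
    _ < ⊤ := hK.measure_lt_top

end quotient

/-- The union of the closed discs of radius `1 / 2` about the points of `K`. -/
def discThickening (K : Set ℍ) : Set ℍ := UpperHalfPlane.coe ⁻¹'
  ((fun p : ℍ × ℂ => discMap p.1 p.2) '' K ×ˢ Metric.closedBall (0 : ℂ) (1 / 2))

theorem isCompact_discThickening {K : Set ℍ} (hK : IsCompact K) : IsCompact (discThickening K) := by
  have hlt : ∀ w ∈ Metric.closedBall (0 : ℂ) (1 / 2), ‖w‖ < 1 := fun w hw =>
    lt_of_le_of_lt (mem_closedBall_zero_iff.mp hw) (by norm_num)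
  refine isOpenEmbedding_coe.isInducing.isCompact_preimage'
    ((hK.prod (isCompact_closedBall _ _)).image_of_continuousOn ?_) ?_
  · unfold discMap
    have h1 : Continuous fun p : ℍ × ℂ => (p.1.re : ℂ) :=
      Complex.continuous_ofReal.comp (continuous_re.comp continuous_fst)
    have h2 : Continuous fun p : ℍ × ℂ => (p.1.im : ℂ) :=
      Complex.continuous_ofReal.comp (continuous_im.comp continuous_fst)
    refine h1.continuousOn.add (h2.continuousOn.mul (ContinuousOn.div (by fun_prop) (by fun_prop)
      fun p hp => one_sub_ne_zero_of_norm_lt_one (hlt _ hp.2)))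
  · rintro _ ⟨p, hp, rfl⟩
    exact ⟨⟨_, im_discMap_pos (hlt _ hp.2)⟩, rfl⟩

theorem subset_discThickening (K : Set ℍ) : K ⊆ discThickening K := fun z hz =>
  ⟨(z, 0), ⟨hz, by simp⟩, discMap_zero⟩

theorem discNbhd_subset_discThickening {K : Set ℍ} {z : ℍ} (hz : z ∈ K) :
    discNbhd z ⊆ discThickening K := by
  rintro ζ ⟨w, hw, hζ⟩
  exact ⟨(z, w), ⟨hz, Metric.ball_subset_closedBall hw⟩, hζ⟩

theorem IsEigenfunction.continuous {Γ : Subgroup SL(2, ℝ)} {k : ℤ} {s : ℂ} {f : ℍ → ℂ}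
    (hf : IsEigenfunction Γ k s f) : Continuous f := by
  have h := hf.contDiffOn.continuousOn.comp_continuous continuous_coe fun z => z.im_pos
  refine h.congr fun z => ?_
  simp

theorem measurable_absQuot {Γ : Subgroup SL(2, ℝ)} {k : ℤ} {f : ℍ → ℂ} (hf : f ∈ weightSpace Γ k)
    (hc : Continuous f) : Measurable (absQuot hf) :=
  measurable_from_quotient.mpr hc.norm.measurable

end WeightEigen

end

/-! ### The estimate on the quotient -/

theorem mainTheorem9 (Γ : Subgroup SL(2, ℝ)) [DiscreteTopology Γ]
    (C : Set (WeightEigen.HQuot Γ)) (hC : IsCompact C) :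
    ∃ C' : Set (WeightEigen.HQuot Γ), IsCompact C' ∧ C ⊆ C' ∧
      ∀ (k : ℤ) (t₀ : ℝ), 0 < t₀ → ∃ A : ℝ, 0 < A ∧
        ∀ t : ℂ, t₀ ≤ ‖t‖ → ∀ (f : ℍ → ℂ)
          (hf : WeightEigen.IsEigenfunction Γ k (1 / 2 + Complex.I * t) f),
          IntegrableOn (fun q => WeightEigen.absQuot hf.mem_weightSpace q ^ 2) C'
            (WeightEigen.quotMeasure Γ) ∧
          ∀ q ∈ C, WeightEigen.absQuot hf.mem_weightSpace q ≤
            A * ‖t‖ ^ (1 / 2 : ℝ) *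
              (∫ q' in C', WeightEigen.absQuot hf.mem_weightSpace q' ^ 2
                ∂(WeightEigen.quotMeasure Γ)) ^ (1 / 2 : ℝ) := by
  open WeightEigen in
  obtain ⟨K, hK, hCK⟩ := exists_isCompact_subset_image_proj hC
  have hK' := isCompact_discThickening hK
  have hC' : IsCompact (proj Γ '' discThickening K) := hK'.image continuous_proj
  obtain ⟨n, hn⟩ := exists_lintegral_le_nat_mul (Γ := Γ) hK'
  refine ⟨proj Γ '' discThickening K, hC', hCK.trans (Set.image_mono (subset_discThickening K)),
    fun k t₀ ht₀ => ?_⟩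
  obtain ⟨B, hB, key⟩ := exists_ofReal_norm_sq_le_lintegral k
  -- `n + 1` instead of `n`, since `n = 0` when `C` is empty.
  refine ⟨√(B * (1 / t₀ + 1) * (n + 1)), by positivity, fun t ht f hf => ?_⟩
  have hfc := hf.continuous
  have hmeas := (measurable_absQuot hf.mem_weightSpace hfc).pow_const 2
  have hint : IntegrableOn (fun q => absQuot hf.mem_weightSpace q ^ 2)
      (proj Γ '' discThickening K) (quotMeasure Γ) := by
    obtain ⟨R, hR⟩ := hK'.exists_bound_of_continuousOn hfc.continuousOn
    refine Measure.integrableOn_of_bounded (M := R ^ 2) (quotMeasure_image_lt_top hK').ne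
      hmeas.aestronglyMeasurable ?_
    refine (ae_restrict_iff' (measurableSet_of_isCompact_quotient hC')).mpr
      (Filter.Eventually.of_forall ?_)
    rintro _ ⟨z, hz, rfl⟩
    rw [norm_pow]
    refine pow_le_pow_left₀ (norm_nonneg _) ?_ 2
    rw [Real.norm_eq_abs]
    exact (abs_norm (f z)).le.trans (hR z hz)
  refine ⟨hint, fun q hq => ?_⟩
  obtain ⟨z, hz, rfl⟩ := hCK hq
  set J := ∫ q' in proj Γ '' discThickening K, absQuot hf.mem_weightSpace q' ^ 2 ∂(quotMeasure Γ)
    with hJ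
  have hJ0 : 0 ≤ J := integral_nonneg fun _ => sq_nonneg _
  set l : ℂ := (1 / 2 + Complex.I * t) * (1 - (1 / 2 + Complex.I * t)) with hl
  have ht0 : 0 < ‖t‖ := ht₀.trans_le ht
  have hsqrt : √(max l.re 1) ≤ (1 / t₀ + 1) * ‖t‖ := by
    have h1 : l = 1 / 4 + t ^ 2 := by
      rw [hl]
      linear_combination -t ^ 2 * Complex.I_sq
    have h2 : l.re ≤ 1 / 4 + ‖t‖ ^ 2 := by
      have h3 := Complex.re_le_norm (t ^ 2)
      rw [norm_pow] at h3
      have h4 : (1 / 4 : ℂ).re = 1 / 4 := by norm_num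
      rw [h1, Complex.add_re, h4]
      linarith
    have h3 : √(max l.re 1) ≤ 1 + ‖t‖ := by
      refine Real.sqrt_le_iff.mpr ⟨by positivity, max_le ?_ ?_⟩ <;> nlinarith
    have h4 : 1 ≤ 1 / t₀ * ‖t‖ := by
      rw [one_div, inv_mul_eq_div, le_div_iff₀ ht₀]
      linarith
    linarith
  have hmain : ‖f z‖ ^ 2 ≤ B * √(max l.re 1) * (n * J) := by
    have h1 : ENNReal.ofReal (‖f z‖ ^ 2) ≤ ENNReal.ofReal (B * √(max l.re 1)) *
        (n * ENNReal.ofReal J) := by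
      refine (key z l f hf.contDiffOn hf.eigen).trans (mul_le_mul_right ?_ _)
      calc ∫⁻ ζ in discNbhd z, ENNReal.ofReal (‖f ζ‖ ^ 2)
          ≤ ∫⁻ ζ in discThickening K, ENNReal.ofReal (‖f ζ‖ ^ 2) :=
            lintegral_mono_set (discNbhd_subset_discThickening hz)
        _ ≤ n * ∫⁻ q in proj Γ '' discThickening K,
              ENNReal.ofReal (absQuot hf.mem_weightSpace q ^ 2) ∂(quotMeasure Γ) :=
            hn _ hmeas.ennreal_ofReal
        _ = n * ENNReal.ofReal J := by
            rw [hJ, ofReal_integral_eq_lintegral_ofReal hint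
              (Filter.Eventually.of_forall fun _ => sq_nonneg _)]
    rw [← ENNReal.ofReal_natCast, ← ENNReal.ofReal_mul (by positivity),
      ← ENNReal.ofReal_mul (by positivity)] at h1
    exact (ENNReal.ofReal_le_ofReal_iff (by positivity)).mp h1
  have hfin : ‖f z‖ ^ 2 ≤ B * (1 / t₀ + 1) * (n + 1) * ‖t‖ * J := by
    refine hmain.trans ?_
    have h1 : B * √(max l.re 1) ≤ B * ((1 / t₀ + 1) * ‖t‖) :=
      mul_le_mul_of_nonneg_left hsqrt hB.le
    have h2 : (n : ℝ) * J ≤ (n + 1) * J := by linarith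
    calc B * √(max l.re 1) * (n * J) ≤ B * ((1 / t₀ + 1) * ‖t‖) * ((n + 1) * J) :=
          mul_le_mul h1 h2 (by positivity) (by positivity)
      _ = _ := by ring
  change ‖f z‖ ≤ _
  rw [← Real.sqrt_eq_rpow, ← Real.sqrt_eq_rpow, ← Real.sqrt_mul (by positivity),
    ← Real.sqrt_mul (by positivity)]
  exact Real.le_sqrt_of_sq_le hfin
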